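/- Let $D\subset\mathbb{R}^2$ be a bounded open set with $0\in D$, let $g$ be a positive continuous function on $\partial D$, and let $f:\mathbb{R}^2\to\mathbb{R}$ be continuous with $0<\lambda<f<\Lambda$ for constants $\lambda,\Lambda$. For $v:\mathbb{R}^2\setminus D\to[0,\infty)$ put $\Omega(v)=\{v>0\}$. A *subsolution* is a continuous $v:\mathbb{R}^2\setminus D\to[0,\infty)$ such that 1. $\Delta v\ge 0$ in $\Omega(v)\setminus\overline D$ in the viscosity sense (if $\varphi$ is $C^2$ near $x_0$ and $v-\varphi$ has a local maximum at $x_0$, then $\Delta\varphi(x_0)\ge 0$); 2. $v\le g$ on $\partial D$; 3. if $x_0\in\partial\Omega(v)\setminus\overline D$, if $B_s(y)$ is a ball disjoint from $\Omega(v)$ with $|x_0-y|=s>0$, and if, with $\nu=(x_0-y)/s$, $v(x)\le\alpha\langle x-x_0,\nu\rangle^+ + o(|x-x_0|)$ near $x_0$, then $\alpha\ge\sqrt{f(x_0)}$. Let $M,r>0$ with $D\subseteq B_r(0)$, and let $$R_0=\inf\Big\{R>r:\ \frac{M^2}{R^2\ln^2(r/R)}<\lambda\Big\},\qquad h(x)=M\Big(\frac{\ln(|x|/R_0)}{\ln(r/R_0)}\Big)^+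 .$$ Let $u$ be the largest subsolution, that is, $u(x)=\sup\{v(x): v \text{ is a subsolution and } v\le h \text{ on } \mathbb{R}^2\setminus D\}$ for $x\in\mathbb{R}^2\setminus D$, and assume that $u$ is continuous on $\mathbb{R}^2\setminus D$. Let $x_0\in\partial\Omega(u)$ and $\rho>0$ with $B_\rho(x_0)\subseteq\mathbb{R}^2\setminus D$, and let $\tilde u(x)=u(x_0-\rho x)/\rho$ for $x\in B_1(0)$. Then no connected component of the interior of the zero set $\{x\in B_1(0):\tilde u(x)=0\}$ is compactly contained in $B_1(0)$, i.e. has its closure contained in $B_1(0)$. -/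

import Mathlib

open Set Filter Topology Asymptotics
open scoped InnerProductSpace Laplacian

noncomputable section

namespace FreeBoundary

/-! The plane `ℝ²` is represented by `ℂ` with its real Euclidean structure: `‖z‖` is the Euclidean
norm, `⟪z, w⟫_ℝ` the Euclidean inner product, and `Δ` Mathlib's Laplacian of a function on a real
inner product space. A function on `ℝ² \ D` is a function `ℂ → ℝ` of which only the values outside
`D` are ever used. -/

/-- The positivity set `Ω(v) = {v > 0}` of a function `v` on `ℝ² \ D`. -/
def posSet (D : Set ℂ) (v : ℂ → ℝ) : Set ℂ := {x | x ∉ D ∧ 0 < v x}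

/-- `Δ v ≥ 0` at `x₀` in the viscosity sense: every `C²` function `φ` that touches `v` from above
at `x₀` (that is, `v - φ` has a local maximum at `x₀`) satisfies `Δ φ (x₀) ≥ 0`. -/
def ViscLaplacianNonneg (v : ℂ → ℝ) (x₀ : ℂ) : Prop :=
  ∀ φ : ℂ → ℝ, ContDiffAt ℝ 2 φ x₀ → IsLocalMax (fun x => v x - φ x) x₀ → 0 ≤ Δ φ x₀

/-- The disk `B_s(y)` is tangent at `x₀` to the set `Ω` from outside of `Ω`. When `x₀ ∈ ∂Ω`, the
unit normal at `x₀` pointing into `Ω` is then `(x₀ - y) / s`. -/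
def TangentBallOutside (Ω : Set ℂ) (x₀ y : ℂ) (s : ℝ) : Prop :=
  0 < s ∧ dist x₀ y = s ∧ Disjoint (Metric.ball y s) Ω

/-- `v(x) ≤ α ⟨x - x₀, ν⟩⁺ + o(|x - x₀|)` in a neighbourhood of `x₀`. -/
def BelowPlane (v : ℂ → ℝ) (x₀ ν : ℂ) (α : ℝ) : Prop :=
  ∃ ω : ℂ → ℝ, ω =o[𝓝 x₀] (fun x => x - x₀) ∧
    ∀ᶠ x in 𝓝 x₀, v x ≤ α * max ⟪x - x₀, ν⟫_ℝ 0 + ω x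

/-- Viscosity subsolutions `v : ℝ² \ D → [0, ∞)` of the free boundary problem
`Δ u = 0` in `Ω(u) \ D`, `u = g` on `∂D`, `u = 0` and `|∇u|² = f` on `∂Ω(u)`.
The interior and the free boundary conditions are imposed at points off `closure D`, where `v` is
defined in a full neighbourhood. -/
structure IsSubsolution (D : Set ℂ) (g f v : ℂ → ℝ) : Prop where
  continuousOn : ContinuousOn v Dᶜ
  nonneg : ∀ x ∉ D, 0 ≤ v x
  subharmonic : ∀ x ∈ posSet D v, x ∉ closure D → ViscLaplacianNonneg v x
  le_boundary : ∀ x ∈ frontier D, v x ≤ g x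
  freeBoundary : ∀ x₀ ∈ frontier (posSet D v), x₀ ∉ closure D →
    ∀ (y : ℂ) (s : ℝ), TangentBallOutside (posSet D v) x₀ y s →
      ∀ α : ℝ, BelowPlane v x₀ ((s : ℂ)⁻¹ * (x₀ - y)) α → √(f x₀) ≤ α

/-- The radius `R₀ = inf {R > r : M² / (R² ln²(r/R)) < lam}`. -/
def outerRadius (lam M r : ℝ) : ℝ :=
  sInf {R : ℝ | r < R ∧ M ^ 2 / (R ^ 2 * Real.log (r / R) ^ 2) < lam}

/-- The barrier `h(x) = M (ln(|x|/R₀) / ln(r/R₀))⁺`: it equals `M` on `∂B_r(0)`, vanishes outside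
`B_{R₀}(0)`, and `|∇h|² = lam` on `∂B_{R₀}(0)`. -/
def barrier (lam M r : ℝ) (x : ℂ) : ℝ :=
  M * max (Real.log (‖x‖ / outerRadius lam M r) / Real.log (r / outerRadius lam M r)) 0

/-- `u` is the largest subsolution: a continuous function on `ℝ² \ D` which is the pointwise
supremum of all subsolutions lying below the barrier. -/
structure IsLargestSubsolution (D : Set ℂ) (g f : ℂ → ℝ) (lam M r : ℝ) (u : ℂ → ℝ) : Prop where
  continuousOn : ContinuousOn u Dᶜ
  isLUB : ∀ x ∉ D, IsLUB {t : ℝ | ∃ v : ℂ → ℝ, IsSubsolution D g f v ∧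
    (∀ z ∉ D, v z ≤ barrier lam M r z) ∧ t = v x} (u x)

/-- The normalization `x ↦ u(x₀ - ρ x) / ρ` of `u` in `B_ρ(x₀)`, a function on `B_1(0)`. -/
def normalized (u : ℂ → ℝ) (x₀ : ℂ) (ρ : ℝ) (x : ℂ) : ℝ := u (x₀ - ρ * x) / ρ

/-- The interior of the zero set of a function on `B_1(0)`. -/
def zeroInterior (w : ℂ → ℝ) : Set ℂ := interior {x | x ∈ Metric.ball (0 : ℂ) 1 ∧ w x = 0}

end FreeBoundary

end

noncomputable section

namespace FreeBoundary

/-! ### Second derivatives at a maximum, and the viscosity inequality -/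

/-! The largest subsolution cannot be raised. It is itself a subsolution, by the Perron argument
(`IsLargestSubsolution.isSubsolution`). Take a continuous w ≥ u that equals u off a compact set away
from the closure of D, exceeds u only inside B_{R₀}, is subharmonic wherever w > u, and has slope at
least √f at the free boundary points lying outside the closure of Ω(u). Then w ≤ u
(`IsLargestSubsolution.maximalOn`). Free boundary points in the closure of Ω(u) need no check: every
tangent disk and every plane testing w there also tests u.

Let E be a component of the interior of the zero set, scaled back, with closure inside the ball.
Near a point of ∂E the function u cannot vanish identically, so ∂E lies in the closure of Ω(u), and
adding to u a small function that is positive exactly on E creates no free boundary point that has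
to be checked. By the maximum principle such a function is not subharmonic on all of E, but it can
be subharmonic off one small disk (`exists_isPartialBump_forall_pos`). It remains to cover that disk
by a larger harmonic function coming in from Ω(u) across ∂E.

To build this function, touch ∂E at z by a disk B ⊆ E and let a be the smallest slope with which u
leaves B at z. The free boundary condition gives a ≥ √f(z). At suitable small scales u lies below a
plane of slope slightly above a and almost reaches it at one point. Maximality makes u harmonic
where it is large compared with the radius (`exists_harmonic_approx`), so a Harnack chain spreads
this near contact, and u lies above a plane of slope slightly below a (`flat_lower_bound`). Adding a
small multiple of Re (1/ζ), with pole inside B, lifts the plane: it becomes positive on a disk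
inside E, falls below u or below 0 on the boundary of a suitable region, and has slope above √f at
its zeros near the edge of B. Its remaining zeros lie in E, where the filling is already positive.
The maximum of the two functions is an admissible competitor strictly above u on E, a contradiction
(`false_of_flat_component`). -/

lemma deriv_deriv_nonpos_of_isLocalMax {q : ℝ → ℝ} {x : ℝ} (hq : ContinuousAt q x)
    (h : IsLocalMax q x) : deriv (deriv q) x ≤ 0 := by
  by_contra! hpos
  have hmin := isLocalMin_of_deriv_deriv_pos hpos h.deriv_eq_zero hq
  have hconst : q =ᶠ[𝓝 x] fun _ => q x := by
    filter_upwards [h, hmin] with y h₁ h₂ using le_antisymm h₁ h₂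
  have := hconst.deriv.deriv_eq
  simp at this
  linarith

lemma iteratedFDeriv_two_nonpos_of_isLocalMax {G : ℂ → ℝ} {x : ℂ} (hG : ContDiffAt ℝ 2 G x)
    (h : IsLocalMax G x) (e : ℂ) : iteratedFDeriv ℝ 2 G x ![e, e] ≤ 0 := by
  set c : ℝ → ℂ := fun t => x + t • e with hc
  have hcd : ∀ t, HasDerivAt c e t := fun t => by
    have := ((hasDerivAt_id t).smul_const e).const_add x
    rwa [one_smul] at this
  have hc0 : c 0 = x := by simp [hc]
  have hcont : Tendsto c (𝓝 0) (𝓝 x) := by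
    have := (hcd 0).continuousAt.tendsto
    rwa [hc0] at this
  have hmax : IsLocalMax (G ∘ c) 0 := by
    have h' : IsLocalMax G (c 0) := by rwa [hc0]
    exact h'.comp_continuous (f := G) (hcd 0).continuousAt
  have hd1 : ∀ᶠ t in 𝓝 (0 : ℝ), HasDerivAt (G ∘ c) (fderiv ℝ G (c t) e) t := by
    have : ∀ᶠ y in 𝓝 x, DifferentiableAt ℝ G y :=
      (hG.eventually (by simp)).mono fun y hy => hy.differentiableAt (by simp)
    filter_upwards [hcont.eventually this] with t ht
    exact ht.hasFDerivAt.comp_hasDerivAt t (hcd t)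
  have hd2 : HasDerivAt (fun t => fderiv ℝ G (c t) e) (fderiv ℝ (fderiv ℝ G) x e e) 0 := by
    have hf : HasFDerivAt (fderiv ℝ G) (fderiv ℝ (fderiv ℝ G) x) (c 0) := by
      rw [hc0]
      exact ((hG.fderiv_right (m := 1) (by norm_num)).differentiableAt (by simp)).hasFDerivAt
    have h1 := hf.comp_hasDerivAt 0 (hcd 0)
    have h2 := h1.clm_apply (hasDerivAt_const (0 : ℝ) e)
    simpa using h2
  have hdd : deriv (deriv (G ∘ c)) 0 = fderiv ℝ (fderiv ℝ G) x e e := by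
    have : deriv (G ∘ c) =ᶠ[𝓝 0] fun t => fderiv ℝ G (c t) e :=
      hd1.mono fun t ht => ht.deriv
    rw [this.deriv_eq]
    exact hd2.deriv
  have := deriv_deriv_nonpos_of_isLocalMax (hd1.self_of_nhds.continuousAt) hmax
  rw [hdd] at this
  simpa [iteratedFDeriv_two_apply] using this

lemma laplacian_nonpos_of_isLocalMax {G : ℂ → ℝ} {x : ℂ} (hG : ContDiffAt ℝ 2 G x)
    (h : IsLocalMax G x) : Δ G x ≤ 0 := by
  rw [InnerProductSpace.laplacian_eq_iteratedFDeriv_complexPlane]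
  exact add_nonpos (iteratedFDeriv_two_nonpos_of_isLocalMax hG h _)
    (iteratedFDeriv_two_nonpos_of_isLocalMax hG h _)

lemma viscLaplacianNonneg_of_laplacian_nonneg {v : ℂ → ℝ} {x : ℂ} (hv : ContDiffAt ℝ 2 v x)
    (h : 0 ≤ Δ v x) : ViscLaplacianNonneg v x := by
  intro φ hφ hmax
  have h1 := laplacian_nonpos_of_isLocalMax (hv.sub hφ) hmax
  have h2 := hv.laplacian_sub hφ
  have : Δ (v - φ) x ≤ 0 := h1
  linarith

lemma viscLaplacianNonneg_of_harmonicAt {v : ℂ → ℝ} {x : ℂ}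
    (hv : InnerProductSpace.HarmonicAt v x) : ViscLaplacianNonneg v x :=
  viscLaplacianNonneg_of_laplacian_nonneg hv.1 hv.2.self_of_nhds.ge

/-- A test function above `w` at `x` is also above `v`. Every maximum or supremum used later is
handled this way: the member attaining the value at `x` touches it from below. -/
lemma ViscLaplacianNonneg.of_touching {v w : ℂ → ℝ} {x : ℂ} (hv : ViscLaplacianNonneg v x)
    (hx : v x = w x) (hle : ∀ᶠ y in 𝓝 x, v y ≤ w y) : ViscLaplacianNonneg w x := by
  intro φ hφ hmax
  refine hv φ hφ ?_
  filter_upwards [hle, hmax] with y h₁ h₂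
  linarith

lemma ViscLaplacianNonneg.const_mul {v : ℂ → ℝ} {x : ℂ} (hv : ViscLaplacianNonneg v x) {c : ℝ}
    (hc : 0 < c) : ViscLaplacianNonneg (fun y => c * v y) x := by
  intro φ hφ hmax
  have h1 : 0 ≤ Δ (c⁻¹ • φ) x := by
    refine hv _ (contDiffAt_const.smul hφ) ?_
    filter_upwards [hmax] with y hy
    have := mul_le_mul_of_nonneg_left hy (inv_nonneg.2 hc.le)
    simpa [mul_sub, hc.ne'] using this
  rw [InnerProductSpace.laplacian_smul _ hφ] at h1
  exact nonneg_of_mul_nonneg_right (by simpa using h1) (inv_pos.2 hc)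

lemma contDiff_norm_sub_sq (c : ℂ) : ContDiff ℝ 2 (fun x : ℂ => ‖x - c‖ ^ 2) :=
  (contDiff_id.sub contDiff_const).norm_sq ℝ

lemma laplacian_norm_sub_sq (c x : ℂ) : Δ (fun y : ℂ => ‖y - c‖ ^ 2) x = 4 := by
  rw [InnerProductSpace.laplacian_eq_iteratedFDeriv_complexPlane]
  have h1 : fderiv ℝ (fun y : ℂ => ‖y - c‖ ^ 2) = fun y => 2 • innerSL ℝ (y - c) := by
    ext1 y
    have : HasFDerivAt (fun y : ℂ => ‖y - c‖ ^ 2) _ y := ((hasFDerivAt_id y).sub_const c).norm_sq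
    rw [this.fderiv]
    ext e
    simp
  have h2 : ∀ y, HasFDerivAt (fun y : ℂ => 2 • innerSL ℝ (y - c))
      (2 • (innerSL ℝ : ℂ →L[ℝ] ℂ →L[ℝ] ℝ)) y := by
    intro y
    have h3 : HasFDerivAt (fun y : ℂ => innerSL ℝ (y - c))
        ((innerSL ℝ : ℂ →L[ℝ] ℂ →L[ℝ] ℝ)) y := by
      exact ((innerSL ℝ : ℂ →L[ℝ] ℂ →L[ℝ] ℝ).hasFDerivAt (x := y - c)).comp y
        ((hasFDerivAt_id y).sub_const c)
    exact h3.const_smul 2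
  simp only [iteratedFDeriv_two_apply, h1, (h2 x).fderiv]
  simp only [smul_apply, Matrix.cons_val_zero, Matrix.cons_val_one, nsmul_eq_mul,
    Nat.cast_ofNat]
  change 2 * ⟪(1 : ℂ), 1⟫_ℝ + 2 * ⟪Complex.I, Complex.I⟫_ℝ = 4
  rw [real_inner_self_eq_norm_sq, real_inner_self_eq_norm_sq]
  norm_num

/-! ### The comparison principle -/

/-- Adding a small multiple of |x - x₁|² makes the inequality strict: at a maximum of the perturbed
difference, H minus that quadratic is a strictly superharmonic test function above `w`. The
conditions are only asked where `H < w`, so boundary values enter by excluding that case. -/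
lemma comparison {K : Set ℂ} (hK : IsCompact K) {w H : ℂ → ℝ} (hw : ContinuousOn w K)
    (hH : ContinuousOn H K)
    (h : ∀ x ∈ K, H x < w x →
      K ∈ 𝓝 x ∧ ViscLaplacianNonneg w x ∧ ContDiffAt ℝ 2 H x ∧ Δ H x ≤ 0) :
    ∀ x ∈ K, w x ≤ H x := by
  intro x₁ hx₁
  by_contra! hlt
  obtain ⟨B, hB⟩ := hK.isBounded.subset_closedBall x₁
  have hB0 : 0 ≤ B := by simpa using (Metric.mem_closedBall.1 (hB hx₁)).trans' dist_nonneg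
  set m := w x₁ - H x₁ with hm
  have hm0 : 0 < m := sub_pos.2 hlt
  -- Keeps the perturbation below half of the assumed excess `m` on all of `K`, so that `w > H` at
  -- the maximum point.
  set ε := m / (2 * (B ^ 2 + 1)) with hε
  have hε0 : 0 < ε := by positivity
  have hεB : ε * B ^ 2 ≤ m / 2 := by
    rw [hε, div_mul_eq_mul_div, div_le_div_iff₀ (by positivity) (by positivity)]
    nlinarith
  have hcont : ContinuousOn (fun x => w x - H x + ε * ‖x - x₁‖ ^ 2) K := by fun_prop
  obtain ⟨z, hzK, hz⟩ := hK.exists_isMaxOn ⟨x₁, hx₁⟩ hcont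
  have hz1 : m ≤ w z - H z + ε * ‖z - x₁‖ ^ 2 := by simpa [hm] using hz hx₁
  have hzB : ‖z - x₁‖ ≤ B := by simpa [dist_eq_norm] using hB hzK
  have hz2 : ε * ‖z - x₁‖ ^ 2 ≤ m / 2 := le_trans (by gcongr) hεB
  obtain ⟨hnK, hv, hH2, hHl⟩ := h z hzK (by linarith)
  have hq : ContDiffAt ℝ 2 (fun x : ℂ => ‖x - x₁‖ ^ 2) z := (contDiff_norm_sub_sq x₁).contDiffAt
  have hq' : ContDiffAt ℝ 2 (ε • fun x : ℂ => ‖x - x₁‖ ^ 2) z := contDiffAt_const.smul hq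
  have h0 := hv (H - ε • fun x : ℂ => ‖x - x₁‖ ^ 2) (hH2.sub hq') (by
    filter_upwards [hnK] with x hx
    have := hz hx
    simp only [mem_ofPred_eq, Pi.sub_apply, Pi.smul_apply, smul_eq_mul] at this ⊢
    linarith)
  rw [hH2.laplacian_sub hq', InnerProductSpace.laplacian_smul _ hq,
    laplacian_norm_sub_sq] at h0
  simp at h0
  linarith

/-! ### The largest subsolution is a subsolution -/

lemma continuousAt_laplacian {φ : ℂ → ℝ} {x : ℂ} (hφ : ContDiffAt ℝ 2 φ x) :
    ContinuousAt (Δ φ) x := by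
  rw [InnerProductSpace.laplacian_eq_iteratedFDeriv_complexPlane]
  have h : ContinuousAt (iteratedFDeriv ℝ 2 φ) x :=
    (hφ.iteratedFDeriv_right (m := 0) (by norm_num)).continuousAt
  have h' : ∀ e : Fin 2 → ℂ, ContinuousAt (fun y => iteratedFDeriv ℝ 2 φ y e) x := fun e =>
    (ContinuousMultilinearMap.apply ℝ (fun _ : Fin 2 => ℂ) ℝ e).continuous.continuousAt.comp h
  exact (h' _).add (h' _)

lemma HarmonicAt.sub_norm_sq {H : ℂ → ℝ} {x : ℂ} (hH : InnerProductSpace.HarmonicAt H x)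
    (c : ℝ) (x₀ : ℂ) :
    ContDiffAt ℝ 2 (fun y => H y - c * ‖y - x₀‖ ^ 2) x ∧
      Δ (fun y => H y - c * ‖y - x₀‖ ^ 2) x = -(4 * c) := by
  have hq : ContDiffAt ℝ 2 (fun x : ℂ => ‖x - x₀‖ ^ 2) x := (contDiff_norm_sub_sq x₀).contDiffAt
  have hq' : ContDiffAt ℝ 2 (c • fun x : ℂ => ‖x - x₀‖ ^ 2) x := contDiffAt_const.smul hq
  refine ⟨hH.1.sub hq', ?_⟩
  have : (fun y => H y - c * ‖y - x₀‖ ^ 2) = H - c • fun x : ℂ => ‖x - x₀‖ ^ 2 := by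
    ext y; simp
  rw [this, hH.1.laplacian_sub hq', InnerProductSpace.laplacian_smul _ hq,
    laplacian_norm_sub_sq, hH.2.self_of_nhds]
  simp
  ring

lemma posSet_mono {D : Set ℂ} {v w : ℂ → ℝ} (h : ∀ x ∉ D, v x ≤ w x) :
    posSet D v ⊆ posSet D w := fun x hx => ⟨hx.1, hx.2.trans_le (h x hx.1)⟩

lemma IsLargestSubsolution.exists_gt {D : Set ℂ} {g f : ℂ → ℝ} {lam M r : ℝ} {u : ℂ → ℝ}
    (hu : IsLargestSubsolution D g f lam M r u) {x : ℂ} (hx : x ∉ D) {c : ℝ} (hc : c < u x) :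
    ∃ v : ℂ → ℝ, IsSubsolution D g f v ∧ (∀ z ∉ D, v z ≤ barrier lam M r z) ∧
      (∀ z ∉ D, v z ≤ u z) ∧ c < v x := by
  obtain ⟨t, ⟨v, hv, hvb, rfl⟩, ht⟩ := (lt_isLUB_iff (hu.isLUB x hx)).1 hc
  exact ⟨v, hv, hvb, fun z hz => (hu.isLUB z hz).1 ⟨v, hv, hvb, rfl⟩, ht⟩

/-- If a test function `φ` for u had negative Laplacian, then φ + ε|x - x₀|² would be a strict test
function with negative Laplacian nearby. It then tests, at a neighbouring point, any subsolution
close enough to u at x₀. -/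
lemma IsLargestSubsolution.viscLaplacianNonneg {D : Set ℂ} {g f : ℂ → ℝ} {lam M r : ℝ} {u : ℂ → ℝ}
    (hu : IsLargestSubsolution D g f lam M r u) {x₀ : ℂ} (hx₀ : x₀ ∉ closure D) (hpos : 0 < u x₀) :
    ViscLaplacianNonneg u x₀ := by
  intro φ hφ hmax
  by_contra! hneg
  set ε := -(Δ φ x₀) / 8 with hε
  have hε0 : 0 < ε := by rw [hε]; linarith
  have hev : ∀ᶠ x in 𝓝 x₀, (u x - φ x ≤ u x₀ - φ x₀ ∧ ContDiffAt ℝ 2 φ x ∧ Δ φ x < -(4 * ε)) ∧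
      x ∉ closure D ∧ φ x₀ - u x₀ / 2 < φ x := by
    refine ((hmax : ∀ᶠ x in 𝓝 x₀, u x - φ x ≤ u x₀ - φ x₀).and
      ((hφ.eventually (by simp)).and ((continuousAt_laplacian hφ).eventually_lt_const ?_))).and
      ((show ∀ᶠ x in 𝓝 x₀, x ∉ closure D from isClosed_closure.isOpen_compl.mem_nhds hx₀).and
        (hφ.continuousAt.eventually_const_lt (by linarith)))
    rw [hε]; linarith
  obtain ⟨δ, hδ, hball⟩ := Metric.nhds_basis_closedBall.mem_iff.1 hev
  have hsub : ∀ x ∈ Metric.closedBall x₀ δ, x ∉ D := fun x hx h =>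
    (hball hx).2.1 (subset_closure h)
  have hx₀D : x₀ ∉ D := fun h => hx₀ (subset_closure h)
  -- The first threshold forces the maximum point `z` off the sphere of radius δ; the second, with φ
  -- > φ(x₀) - u(x₀)/2 on the ball, gives `0 < v z`.
  obtain ⟨v, hv, -, hvu, hvx⟩ := hu.exists_gt hx₀D
    (c := max (u x₀ - ε * δ ^ 2) (u x₀ / 2)) (by
      have := mul_pos hε0 (pow_pos hδ 2)
      simp only [max_lt_iff]; constructor <;> linarith)
  rw [max_lt_iff] at hvx
  have hφc : ContinuousOn φ (Metric.closedBall x₀ δ) := fun x hx =>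
    (hball hx).1.2.1.continuousAt.continuousWithinAt
  have hvc : ContinuousOn v (Metric.closedBall x₀ δ) := hv.continuousOn.mono hsub
  obtain ⟨z, hz, hzmax⟩ := (isCompact_closedBall x₀ δ).exists_isMaxOn
    ⟨x₀, Metric.mem_closedBall_self hδ.le⟩
    (f := fun x => v x - (φ x + ε * ‖x - x₀‖ ^ 2)) (by fun_prop)
  have h1 : v x₀ - φ x₀ ≤ v z - (φ z + ε * ‖z - x₀‖ ^ 2) := by
    simpa using hzmax (Metric.mem_closedBall_self hδ.le)
  have hzu := hvu z (hsub z hz)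
  have hzb := hball hz
  have hzint : z ∈ Metric.ball x₀ δ := by
    rw [Metric.mem_ball]
    refine lt_of_le_of_ne (Metric.mem_closedBall.1 hz) fun h => ?_
    rw [dist_eq_norm] at h
    rw [h] at h1
    linarith [hzb.1.1]
  have hvz : 0 < v z := by
    have : 0 ≤ ε * ‖z - x₀‖ ^ 2 := by positivity
    linarith [hzb.2.2]
  have hq : ContDiffAt ℝ 2 (fun x : ℂ => ‖x - x₀‖ ^ 2) z := (contDiff_norm_sub_sq x₀).contDiffAt
  have hq' : ContDiffAt ℝ 2 (ε • fun x : ℂ => ‖x - x₀‖ ^ 2) z := contDiffAt_const.smul hq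
  have h0 := hv.subharmonic z ⟨hsub z hz, hvz⟩ hzb.2.1
    (φ + ε • fun x : ℂ => ‖x - x₀‖ ^ 2) (hzb.1.2.1.add hq') (by
      filter_upwards [Metric.isOpen_ball.mem_nhds hzint] with x hx
      have := hzmax (Metric.ball_subset_closedBall hx)
      simpa using this)
  rw [hzb.1.2.1.laplacian_add hq', InnerProductSpace.laplacian_smul _ hq,
    laplacian_norm_sub_sq] at h0
  have := hzb.1.2.2
  simp at h0
  linarith

/-- A quadratic polynomial, strictly superharmonic for `0 < c`, written in the orthonormal frame
`(ν, iν)` at `x₀`. -/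
def quadBarrier (x₀ ν : ℂ) (α c : ℝ) (x : ℂ) : ℝ :=
  (α * ((x - x₀) * (starRingEnd ℂ) ν) - (3 * c : ℝ) * ((x - x₀) * (starRingEnd ℂ) ν) ^ 2).re -
    c * ‖x - x₀‖ ^ 2

lemma norm_sq_eq_frame {ν : ℂ} (hν : ‖ν‖ = 1) (h : ℂ) :
    ‖h‖ ^ 2 = (h * (starRingEnd ℂ) ν).re ^ 2 + (h * (starRingEnd ℂ) ν).im ^ 2 := by
  have : ‖h‖ = ‖h * (starRingEnd ℂ) ν‖ := by simp [hν]
  rw [this, ← Complex.normSq_eq_norm_sq, Complex.normSq_apply]; ring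

lemma inner_eq_frame (h ν : ℂ) : ⟪h, ν⟫_ℝ = (h * (starRingEnd ℂ) ν).re := by
  simp [Complex.inner]; ring

lemma quadBarrier_eq {x₀ ν : ℂ} (hν : ‖ν‖ = 1) (α c : ℝ) (x : ℂ) :
    quadBarrier x₀ ν α c x = α * ((x - x₀) * (starRingEnd ℂ) ν).re +
      2 * c * (((x - x₀) * (starRingEnd ℂ) ν).im ^ 2 -
        2 * ((x - x₀) * (starRingEnd ℂ) ν).re ^ 2) := by
  rw [quadBarrier, norm_sq_eq_frame hν]
  generalize (x - x₀) * (starRingEnd ℂ) ν = ζ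
  simp [pow_two]
  ring

lemma quadBarrier_contDiffAt_laplacian (x₀ ν : ℂ) (α c : ℝ) (x : ℂ) :
    ContDiffAt ℝ 2 (quadBarrier x₀ ν α c) x ∧ Δ (quadBarrier x₀ ν α c) x = -(4 * c) := by
  refine HarmonicAt.sub_norm_sq (H := fun x => (α * ((x - x₀) * (starRingEnd ℂ) ν) -
    (3 * c : ℝ) * ((x - x₀) * (starRingEnd ℂ) ν) ^ 2).re) ?_ c x₀
  apply AnalyticAt.harmonicAt_re
  fun_prop

/-- The gradient of `quadBarrier` at `x₁`. -/
def quadGrad (x₀ ν : ℂ) (α c : ℝ) (x₁ : ℂ) : ℂ :=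
  ⟨α - 8 * c * ((x₁ - x₀) * (starRingEnd ℂ) ν).re,
    4 * c * ((x₁ - x₀) * (starRingEnd ℂ) ν).im⟩ * ν

lemma quadBarrier_sub_le {x₀ ν : ℂ} (hν : ‖ν‖ = 1) (α : ℝ) {c : ℝ} (hc : 0 ≤ c) (x₁ x : ℂ) :
    quadBarrier x₀ ν α c x - quadBarrier x₀ ν α c x₁ ≤
      ⟪x - x₁, quadGrad x₀ ν α c x₁⟫_ℝ + 2 * c * ‖x - x₁‖ ^ 2 := by
  rw [quadBarrier_eq hν, quadBarrier_eq hν, norm_sq_eq_frame hν, inner_eq_frame, quadGrad]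
  have h1 : x - x₀ = (x - x₁) + (x₁ - x₀) := by ring
  rw [h1, add_mul, map_mul]
  set ζ := (x₁ - x₀) * (starRingEnd ℂ) ν
  have h2 : ∀ a : ℂ, (x - x₁) * ((starRingEnd ℂ) a * (starRingEnd ℂ) ν) =
      (x - x₁) * (starRingEnd ℂ) ν * (starRingEnd ℂ) a := fun a => by ring
  rw [h2]
  set ξ := (x - x₁) * (starRingEnd ℂ) ν
  simp
  nlinarith [mul_nonneg hc (sq_nonneg ξ.re)]

lemma quadGrad_norm_bounds {x₀ ν : ℂ} (hν : ‖ν‖ = 1) {α c δ : ℝ} (hc : 0 ≤ c) {x₁ : ℂ}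
    (hx : ‖x₁ - x₀‖ ≤ δ) : α - 8 * c * δ ≤ ‖quadGrad x₀ ν α c x₁‖ ∧
      ‖quadGrad x₀ ν α c x₁‖ ≤ |α| + 12 * c * δ := by
  have hz : ‖(x₁ - x₀) * (starRingEnd ℂ) ν‖ ≤ δ := by simpa [hν] using hx
  rw [quadGrad, norm_mul, hν, mul_one]
  set ζ := (x₁ - x₀) * (starRingEnd ℂ) ν
  have hre := (Complex.abs_re_le_norm ζ).trans hz
  have him := (Complex.abs_im_le_norm ζ).trans hz
  have hδ : 0 ≤ δ := (abs_nonneg _).trans hre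
  rw [abs_le] at hre
  constructor
  · refine le_trans ?_ ((le_abs_self _).trans (Complex.abs_re_le_norm _))
    simp only
    nlinarith
  · refine (Complex.norm_le_abs_re_add_abs_im _).trans ?_
    simp only
    have h1 : |α - 8 * c * ζ.re| ≤ |α| + 8 * c * δ := by
      refine (abs_sub _ _).trans ?_
      rw [abs_mul, abs_of_nonneg (by positivity : 0 ≤ 8 * c)]
      gcongr
      exact abs_le.2 hre
    have h2 : |4 * c * ζ.im| ≤ 4 * c * δ := by
      rw [abs_mul, abs_of_nonneg (by positivity : 0 ≤ 4 * c)]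
      gcongr
    linarith

lemma norm_sub_ge_of_mem_closure {Ω : Set ℂ} {y x : ℂ} {s : ℝ}
    (h : Disjoint (Metric.ball y s) Ω) (hx : x ∈ closure Ω) : s ≤ ‖x - y‖ := by
  have := (h.closure_right Metric.isOpen_ball).notMem_of_mem_right hx
  simpa [dist_eq_norm] using this

/-- The function `quadBarrier` stays above the linear growth `α t⁺ + ε δ` on the part of the circle
of radius `δ` which is outside of the tangent disk of radius `s`. -/
lemma quadBarrier_lower_bound {α₀ γ δ s t X : ℝ} (hα₀ : 0 ≤ α₀) (hγ : 0 < γ) (hδ : 0 < δ)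
    (hs : 0 < s) (hδs : δ ≤ s) (hδs' : (α₀ + γ / 4) * δ ≤ γ * s / 512)
    (hcirc : t ^ 2 + X ^ 2 = δ ^ 2) (ht : -δ ^ 2 ≤ 2 * s * t) :
    α₀ * max t 0 + γ / 1024 * δ + γ / 512 * δ ≤
      (α₀ + γ / 4) * t + 2 * (γ / (128 * δ)) * (X ^ 2 - 2 * t ^ 2) := by
  have e : 2 * (γ / (128 * δ)) * (X ^ 2 - 2 * t ^ 2) = γ * δ / 64 - 3 * γ * t ^ 2 / (64 * δ) := by
    have : X ^ 2 = δ ^ 2 - t ^ 2 := by linarith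
    rw [this]; field_simp; ring
  rw [e]
  have htδ : t ≤ δ := by nlinarith [sq_nonneg X]
  rcases le_total 0 t with h0 | h0
  · rw [max_eq_left h0]
    have h1 : 3 * γ * t ^ 2 / (64 * δ) ≤ 3 * γ * t / 64 := by
      rw [div_le_div_iff₀ (by positivity) (by norm_num)]
      nlinarith [mul_nonneg (mul_nonneg hγ.le h0) (sub_nonneg.2 htδ)]
    nlinarith [mul_nonneg hγ.le h0]
  · rw [max_eq_right h0]
    have h2 : -(δ / 2) ≤ t := by
      by_contra! h; nlinarith
    have h1 : 3 * γ * t ^ 2 / (64 * δ) ≤ 3 * γ * δ / 256 := by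
      rw [div_le_div_iff₀ (by positivity) (by norm_num)]
      nlinarith [mul_nonneg hγ.le (mul_nonneg (by linarith : 0 ≤ δ / 2 - t) (by linarith : 0 ≤ δ / 2 + t))]
    have h3 : -(γ * δ / 1024) ≤ (α₀ + γ / 4) * t := by
      have h4 : (α₀ + γ / 4) * (-δ ^ 2) ≤ (α₀ + γ / 4) * (2 * s * t) :=
        mul_le_mul_of_nonneg_left ht (by positivity)
      have h5 : (α₀ + γ / 4) * δ * δ ≤ γ * s / 512 * δ := by gcongr
      have h6 : s * (-(γ * δ / 1024)) ≤ s * ((α₀ + γ / 4) * t) := by nlinarith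
      exact le_of_mul_le_mul_left h6 hs
    nlinarith

/-- At a free boundary point where a subsolution `v` is locally below a level of `quadBarrier`,
the slope of `quadBarrier` is at least `√f`. -/
lemma IsSubsolution.sqrt_le_quadGrad {D : Set ℂ} {g f v : ℂ → ℝ} (hv : IsSubsolution D g f v)
    {x₀ ν x₁ : ℂ} (hν : ‖ν‖ = 1) {α c : ℝ} (hc : 0 < c)
    (hG : quadGrad x₀ ν α c x₁ ≠ 0) {ε : ℝ} (hε : 0 < ε) (hx₁ : x₁ ∈ closure (posSet D v))
    (hx₁D : x₁ ∉ closure D) (hv0 : v x₁ ≤ 0)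
    (hle : ∀ x ∈ Metric.ball x₁ ε, x ∈ posSet D v →
      v x ≤ quadBarrier x₀ ν α c x - quadBarrier x₀ ν α c x₁)
    (hball : Metric.ball x₁ ε ⊆ Dᶜ) :
    √(f x₁) ≤ ‖quadGrad x₀ ν α c x₁‖ := by
  set G := quadGrad x₀ ν α c x₁ with hGdef
  have hGn : 0 < ‖G‖ := norm_pos_iff.2 hG
  set n : ℂ := (‖G‖ : ℂ)⁻¹ * G with hn
  have hn1 : ‖n‖ = 1 := by simp [hn, hGn.ne']
  have hGin : ∀ k : ℂ, ⟪k, G⟫_ℝ = ‖G‖ * ⟪k, n⟫_ℝ := by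
    intro k
    have : G = ‖G‖ • n := by
      rw [hn, Complex.real_smul, mul_inv_cancel_left₀ (by exact_mod_cast hGn.ne')]
    conv_lhs => rw [this]
    rw [inner_smul_right]
  -- For σ ≤ ‖G‖/(4c) the disk of radius σ behind `x₁` lies where ‖G‖⟨x - x₁, n⟩ + 2c|x - x₁|² is
  -- negative, hence off Ω(v); σ ≤ ε/3 keeps it inside the ball where the bound on `v` is known.
  set σ := min (ε / 3) (‖G‖ / (4 * c)) with hσ
  have hσ0 : 0 < σ := by positivity
  have hσε : σ ≤ ε / 3 := min_le_left _ _
  have hσG : 4 * c * σ ≤ ‖G‖ := by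
    have : σ ≤ ‖G‖ / (4 * c) := min_le_right _ _
    rw [le_div_iff₀ (by positivity)] at this
    linarith
  have hkey : ∀ x ∈ Metric.ball x₁ ε, x ∈ posSet D v →
      v x ≤ ‖G‖ * ⟪x - x₁, n⟫_ℝ + 2 * c * ‖x - x₁‖ ^ 2 := by
    intro x hx hxv
    have := quadBarrier_sub_le (x₀ := x₀) hν α hc.le x₁ x
    rw [← hGdef, hGin] at this
    linarith [hle x hx hxv]
  have hfront : x₁ ∈ frontier (posSet D v) := by
    refine ⟨hx₁, fun h => ?_⟩
    exact absurd (interior_subset h).2 (not_lt.2 hv0)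
  refine hv.freeBoundary x₁ hfront hx₁D (x₁ - σ * n) σ ⟨hσ0, ?_, ?_⟩ ‖G‖ ?_
  · simp [hn1, abs_of_pos hσ0]
  · rw [Set.disjoint_left]
    intro x hx hxv
    rw [Metric.mem_ball, dist_eq_norm] at hx
    have hxe : x - (x₁ - σ * n) = (x - x₁) + σ • n := by rw [Complex.real_smul]; ring
    rw [hxe] at hx
    have hx2 : ‖(x - x₁) + σ • n‖ ^ 2 < σ ^ 2 := by gcongr
    rw [norm_add_sq_real, inner_smul_right, norm_smul, hn1] at hx2
    simp only [Real.norm_eq_abs, mul_one, sq_abs] at hx2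
    have hxball : x ∈ Metric.ball x₁ ε := by
      rw [Metric.mem_ball, dist_eq_norm]
      have : ‖x - x₁‖ ≤ ‖(x - x₁) + σ • n‖ + ‖σ • n‖ := by
        simpa using norm_sub_le ((x - x₁) + σ • n) (σ • n)
      rw [norm_smul, hn1, Real.norm_eq_abs, abs_of_pos hσ0] at this
      linarith
    have h1 := hkey x hxball hxv
    have h2 := hxv.2
    have h3 : 4 * c * σ * ‖x - x₁‖ ^ 2 ≤ ‖G‖ * ‖x - x₁‖ ^ 2 := by gcongr
    have h4 : ‖G‖ * (‖x - x₁‖ ^ 2 + 2 * (σ * ⟪x - x₁, n⟫_ℝ)) < 0 :=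
      mul_neg_of_pos_of_neg hGn (by linarith)
    have h5 : 0 < σ * (‖G‖ * ⟪x - x₁, n⟫_ℝ + 2 * c * ‖x - x₁‖ ^ 2) :=
      mul_pos hσ0 (by linarith)
    nlinarith
  · have hν' : (σ : ℂ)⁻¹ * (x₁ - (x₁ - σ * n)) = n := by
      have : (σ : ℂ) ≠ 0 := by exact_mod_cast hσ0.ne'
      field_simp; ring
    rw [hν']
    refine ⟨fun x => 2 * c * ‖x - x₁‖ ^ 2, ?_, ?_⟩
    · refine IsLittleO.const_mul_left ?_ _
      have : Tendsto (fun x : ℂ => x - x₁) (𝓝 x₁) (𝓝 0) := by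
        have : ContinuousAt (fun x : ℂ => x - x₁) x₁ := by fun_prop
        simpa [ContinuousAt] using this
      exact (isLittleO_norm_pow_id (E' := ℂ) one_lt_two).comp_tendsto this
    · filter_upwards [Metric.ball_mem_nhds x₁ hε] with x hx
      by_cases hxv : x ∈ posSet D v
      · refine (hkey x hx hxv).trans ?_
        gcongr
        exact le_max_left _ _
      · have : v x ≤ 0 := by
          by_contra! h
          exact hxv ⟨hball hx, h⟩
        refine this.trans (add_nonneg (by positivity) (by positivity))

/-- If α were less than √f(x₀), a strictly superharmonic quadratic Φ of slope below √f would lie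
above u on the relevant part of a small circle. A subsolution positive near x₀ then touches a level
of Φ from below inside, either where it is positive, against subharmonicity, or at its free
boundary, against the slope condition. -/
lemma IsLargestSubsolution.sqrt_le {D : Set ℂ} {g f : ℂ → ℝ} {lam M r : ℝ} {u : ℂ → ℝ}
    (hu : IsLargestSubsolution D g f lam M r u) (hf : Continuous f) (hfpos : ∀ x, 0 < f x)
    {x₀ y : ℂ} {s α : ℝ} (hx₀ : x₀ ∈ frontier (posSet D u)) (hx₀D : x₀ ∉ closure D)
    (hT : TangentBallOutside (posSet D u) x₀ y s)
    (hB : BelowPlane u x₀ ((s : ℂ)⁻¹ * (x₀ - y)) α) : √(f x₀) ≤ α := by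
  by_contra! hlt
  obtain ⟨hs, hdist, hdisj⟩ := hT
  set ν := (s : ℂ)⁻¹ * (x₀ - y) with hν
  have hν1 : ‖ν‖ = 1 := by
    rw [hν, norm_mul, ← dist_eq_norm, hdist]
    simp [abs_of_pos hs, hs.ne']
  have hyν : y = x₀ - s * ν := by
    have : (s : ℂ) ≠ 0 := by exact_mod_cast hs.ne'
    rw [hν]; field_simp; ring
  set α₀ := max α 0 with hα₀
  have hα₀0 : 0 ≤ α₀ := le_max_right _ _
  set γ := √(f x₀) - α₀ with hγdef
  have hγ : 0 < γ := sub_pos.2 (max_lt hlt (Real.sqrt_pos.2 (hfpos _)))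
  obtain ⟨ω, hω, hωle⟩ := hB
  have hcf : ContinuousAt (fun x => √(f x)) x₀ := by fun_prop
  have hev : ∀ᶠ x in 𝓝 x₀, (u x ≤ α * max ⟪x - x₀, ν⟫_ℝ 0 + ω x ∧
      ‖ω x‖ ≤ γ / 1024 * ‖x - x₀‖) ∧ x ∉ closure D ∧ α₀ + γ / 2 < √(f x) := by
    refine (hωle.and (hω.def (by positivity))).and
      ((show ∀ᶠ x in 𝓝 x₀, x ∉ closure D from isClosed_closure.isOpen_compl.mem_nhds hx₀D).and
        (hcf.eventually_const_lt ?_))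
    simp only [hγdef]; linarith
  obtain ⟨δ₁, hδ₁, hball⟩ := Metric.nhds_basis_closedBall.mem_iff.1 hev
  set δ := min δ₁ (min s (γ * s / 512 / (α₀ + γ / 4))) with hδdef
  have hδ : 0 < δ := by positivity
  have hδs : δ ≤ s := (min_le_right _ _).trans (min_le_left _ _)
  have hδs' : (α₀ + γ / 4) * δ ≤ γ * s / 512 := by
    have : δ ≤ γ * s / 512 / (α₀ + γ / 4) := (min_le_right _ _).trans (min_le_right _ _)
    rw [le_div_iff₀ (by positivity)] at this
    linarith
  replace hball : ∀ x ∈ Metric.closedBall x₀ δ, _ := fun x hx =>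
    hball (Metric.closedBall_subset_closedBall (min_le_left _ _) hx)
  have hDc : ∀ x ∈ Metric.closedBall x₀ δ, x ∉ D := fun x hx h =>
    (hball x hx).2.1 (subset_closure h)
  -- Scaled so that the quadratic part of Φ has size γδ on the circle, while the gradient varies by
  -- at most 12cδ = 3γ/32. Slopes of Φ thus stay below α₀ + γ/2, hence below √f.
  set c := γ / (128 * δ) with hc
  have hc0 : 0 < c := by positivity
  have hcδ : c * δ = γ / 128 := by rw [hc]; field_simp
  set Φ := quadBarrier x₀ ν (α₀ + γ / 4) c with hΦ
  have hΦc : Continuous Φ := continuous_iff_continuousAt.2 fun x =>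
    (quadBarrier_contDiffAt_laplacian x₀ ν (α₀ + γ / 4) c x).1.continuousAt
  have hΦ0 : Φ x₀ = 0 := by simp [hΦ, quadBarrier]
  -- on the circle, the barrier is above `u` on the closure of the positivity set
  have hsphere : ∀ x ∈ closure (posSet D u), ‖x - x₀‖ = δ → u x + γ / 512 * δ ≤ Φ x := by
    intro x hx hxδ
    have hxb := hball x (by simp [dist_eq_norm, hxδ])
    have h1 := norm_sub_ge_of_mem_closure hdisj hx
    have h2 : x - y = (x - x₀) + s • ν := by rw [hyν, Complex.real_smul]; ring
    have h3 : s ^ 2 ≤ ‖(x - x₀) + s • ν‖ ^ 2 := by rw [← h2]; gcongr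
    rw [norm_add_sq_real, inner_smul_right, norm_smul, hν1, hxδ] at h3
    simp only [Real.norm_eq_abs, mul_one, sq_abs] at h3
    have h4 := quadBarrier_lower_bound (t := ((x - x₀) * (starRingEnd ℂ) ν).re)
      (X := ((x - x₀) * (starRingEnd ℂ) ν).im) hα₀0 hγ hδ hs hδs hδs'
      (by rw [← norm_sq_eq_frame hν1, hxδ]) (by rw [← inner_eq_frame]; linarith)
    rw [hΦ, quadBarrier_eq hν1, hc]
    refine le_trans ?_ h4
    have h5 := hxb.1.1
    rw [inner_eq_frame] at h5
    have h6 := (le_abs_self (ω x)).trans hxb.1.2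
    rw [hxδ] at h6
    have h7 : α * max ((x - x₀) * (starRingEnd ℂ) ν).re 0 ≤
        α₀ * max ((x - x₀) * (starRingEnd ℂ) ν).re 0 := by
      gcongr
      exact le_max_left _ _
    linarith
  -- a subsolution which is positive close to `x₀`
  obtain ⟨xθ, ⟨hxθΦ, hxθb⟩, hxθ⟩ := mem_closure_iff_nhds.1 hx₀.1
    ({x | Φ x < γ / 512 * δ} ∩ Metric.ball x₀ δ)
    (inter_mem ((hΦc.continuousAt).eventually_lt_const (by rw [hΦ0]; positivity))
      (Metric.ball_mem_nhds _ hδ))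
  obtain ⟨v, hv, -, hvu, hvpos⟩ := hu.exists_gt hxθ.1 hxθ.2
  have hvΩ : posSet D v ⊆ posSet D u := posSet_mono hvu
  have hKc : IsCompact (Metric.closedBall x₀ δ ∩ closure (posSet D v)) :=
    (isCompact_closedBall _ _).inter_right isClosed_closure
  have hvc : ContinuousOn v (Metric.closedBall x₀ δ) := hv.continuousOn.mono hDc
  have hxθK : xθ ∈ Metric.closedBall x₀ δ ∩ closure (posSet D v) :=
    ⟨Metric.ball_subset_closedBall hxθb, subset_closure ⟨hxθ.1, hvpos⟩⟩
  -- Maximizing over the closure of Ω(v) rather than the whole disk is essential: inside the tangent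
  -- disk Φ may be negative and gives no bound.
  obtain ⟨x₁, ⟨hx₁b, hx₁v⟩, hmax⟩ := hKc.exists_isMaxOn ⟨xθ, hxθK⟩
    (f := fun x => v x - Φ x) ((hvc.mono inter_subset_left).sub hΦc.continuousOn)
  have h1 : v xθ - Φ xθ ≤ v x₁ - Φ x₁ := hmax hxθK
  have hxθΦ' : Φ xθ < γ / 512 * δ := hxθΦ
  have hx₁int : x₁ ∈ Metric.ball x₀ δ := by
    rw [Metric.mem_ball]
    refine lt_of_le_of_ne (Metric.mem_closedBall.1 hx₁b) fun h => ?_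
    rw [dist_eq_norm] at h
    have h2 := hsphere x₁ (closure_mono hvΩ hx₁v) h
    have h3 := hvu x₁ (hDc x₁ hx₁b)
    linarith
  have hx₁D := (hball x₁ hx₁b).2.1
  obtain ⟨ε, hε, hεb⟩ := Metric.isOpen_iff.1 Metric.isOpen_ball x₁ hx₁int
  have hmax' : ∀ x ∈ Metric.ball x₁ ε, x ∈ posSet D v → v x - Φ x ≤ v x₁ - Φ x₁ :=
    fun x hx hxv => hmax ⟨Metric.ball_subset_closedBall (hεb hx), subset_closure hxv⟩
  -- Either `x₁` is an interior point of positivity, excluded by ΔΦ < 0, or a free boundary point of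
  -- `v` where the slope of Φ is too small.
  rcases lt_or_ge 0 (v x₁) with hpos | hnp
  · have hQ := quadBarrier_contDiffAt_laplacian x₀ ν (α₀ + γ / 4) c x₁
    have hvat : ContinuousAt v x₁ := hvc.continuousAt
      (mem_of_superset (Metric.isOpen_ball.mem_nhds hx₁int) Metric.ball_subset_closedBall)
    have := hv.subharmonic x₁ ⟨hDc x₁ hx₁b, hpos⟩ hx₁D Φ hQ.1 (by
      filter_upwards [Metric.ball_mem_nhds x₁ hε, hvat.eventually_const_lt hpos] with x hx hx'
      exact hmax' x hx ⟨hDc x (Metric.ball_subset_closedBall (hεb hx)), hx'⟩)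
    rw [hQ.2] at this
    linarith
  · have hv0 : v x₁ = 0 := le_antisymm hnp (hv.nonneg x₁ (hDc x₁ hx₁b))
    have hbounds := quadGrad_norm_bounds (x₀ := x₀) (α := α₀ + γ / 4) hν1 hc0.le (x₁ := x₁)
      (by simpa [dist_eq_norm] using hx₁b)
    rw [abs_of_nonneg (by positivity)] at hbounds
    have hG : quadGrad x₀ ν (α₀ + γ / 4) c x₁ ≠ 0 := by
      intro h
      rw [h, norm_zero] at hbounds
      linarith [hbounds.1]
    have := hv.sqrt_le_quadGrad hν1 hc0 hG hε hx₁v hx₁D hnp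
      (fun x hx hxv => by have := hmax' x hx hxv; rw [hv0] at this; simp only [← hΦ]; linarith)
      (fun x hx => hDc x (Metric.ball_subset_closedBall (hεb hx)))
    have h3 := (hball x₁ hx₁b).2.2
    linarith [hbounds.2]

lemma IsLargestSubsolution.isSubsolution {D : Set ℂ} {g f : ℂ → ℝ} {lam M r : ℝ} {u : ℂ → ℝ}
    (hD : IsOpen D)
    (hu : IsLargestSubsolution D g f lam M r u) (hf : Continuous f) (hfpos : ∀ x, 0 < f x) :
    IsSubsolution D g f u where
  continuousOn := hu.continuousOn
  nonneg x hx := by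
    obtain ⟨v, hv, -, hvu, -⟩ := hu.exists_gt hx (sub_one_lt (u x))
    exact (hv.nonneg x hx).trans (hvu x hx)
  subharmonic x hx hxD := hu.viscLaplacianNonneg hxD hx.2
  le_boundary x hx := by
    have hxD : x ∉ D := fun h => hx.2 (by rwa [hD.interior_eq])
    refine (isLUB_le_iff (hu.isLUB x hxD)).2 ?_
    rintro _ ⟨v, hv, -, rfl⟩
    exact hv.le_boundary x hx
  freeBoundary x₀ hx₀ hx₀D y s hT α hB := hu.sqrt_le hf hfpos hx₀ hx₀D hT hB

lemma IsLargestSubsolution.le_barrier {D : Set ℂ} {g f : ℂ → ℝ} {lam M r : ℝ} {u : ℂ → ℝ}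
    (hu : IsLargestSubsolution D g f lam M r u) {x : ℂ} (hx : x ∉ D) :
    u x ≤ barrier lam M r x := by
  refine (isLUB_le_iff (hu.isLUB x hx)).2 ?_
  rintro _ ⟨v, -, hvb, rfl⟩
  exact hvb x hx

/-! ### Competitors -/

lemma harmonicAt_log_norm_sub {q x : ℂ} (hx : x ≠ q) (A B : ℝ) :
    InnerProductSpace.HarmonicAt (fun y => A * Real.log ‖y - q‖ + B) x := by
  have h1 : AnalyticAt ℂ (fun y : ℂ => y - q) x := by fun_prop
  have h2 := (h1.harmonicAt_log_norm (sub_ne_zero.2 hx)).const_smul (c := A)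
  have h3 := h2.add (InnerProductSpace.harmonicAt_const (x := x) B)
  exact h3

lemma log_div_outerRadius_neg {lam M r : ℝ} (hr : 0 < r) (hR : r < outerRadius lam M r) :
    Real.log (r / outerRadius lam M r) < 0 :=
  Real.log_neg (by have := hr.trans hR; positivity) ((div_lt_one (hr.trans hR)).2 hR)

lemma continuousAt_barrier {lam M r : ℝ} (hr : 0 < r) (hR : r < outerRadius lam M r) {x : ℂ}
    (hx : x ≠ 0) : ContinuousAt (barrier lam M r) x := by
  have hR0 := hr.trans hR
  have h : ‖x‖ / outerRadius lam M r ≠ 0 := div_ne_zero (norm_ne_zero_iff.2 hx) hR0.ne'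
  unfold barrier
  have h1 : ContinuousAt (fun x : ℂ => Real.log (‖x‖ / outerRadius lam M r)) x :=
    ContinuousAt.log (by fun_prop) h
  fun_prop

lemma barrier_eq_zero {lam M r : ℝ} (hr : 0 < r) (hR : r < outerRadius lam M r) {x : ℂ}
    (hx : outerRadius lam M r ≤ ‖x‖) : barrier lam M r x = 0 := by
  have h1 := log_div_outerRadius_neg hr hR
  have h2 : 0 ≤ Real.log (‖x‖ / outerRadius lam M r) :=
    Real.log_nonneg ((one_le_div (hr.trans hR)).2 hx)
  rw [barrier, max_eq_right (div_nonpos_of_nonneg_of_nonpos h2 h1.le), mul_zero]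

lemma harmonicAt_barrier {lam M r : ℝ} (hr : 0 < r) (hR : r < outerRadius lam M r) {x : ℂ}
    (hx0 : x ≠ 0) (hx : ‖x‖ < outerRadius lam M r) :
    InnerProductSpace.HarmonicAt (barrier lam M r) x := by
  have hR0 := hr.trans hR
  have hneg := log_div_outerRadius_neg hr hR
  set R := outerRadius lam M r with hRdef
  set k := Real.log (r / R)
  have hev : barrier lam M r =ᶠ[𝓝 x]
      fun y => M / k * Real.log ‖y - 0‖ + (-(M / k * Real.log R)) := by
    have hcn : ContinuousAt (fun y : ℂ => ‖y‖) x := by fun_prop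
    filter_upwards [hcn.eventually_lt_const hx,
      hcn.eventually_const_lt (norm_pos_iff.2 hx0)] with y hy hy0
    have h2 : Real.log (‖y‖ / R) ≤ 0 :=
      Real.log_nonpos (by positivity) ((div_le_one hR0).2 hy.le)
    rw [barrier, max_eq_left (div_nonneg_of_nonpos h2 hneg.le), Real.log_div hy0.ne' hR0.ne']
    simp only [sub_zero]
    ring
  exact (InnerProductSpace.harmonicAt_congr_nhds hev).2 (harmonicAt_log_norm_sub hx0 _ _)

/-- `u` cannot be increased, within `G` and away from `D`, to a function `w` which is subharmonic
where it exceeds `u` and steep enough at the free boundary points which it creates. -/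
def MaximalOn (D : Set ℂ) (f u : ℂ → ℝ) (G : Set ℂ) : Prop :=
  ∀ (w : ℂ → ℝ) (K : Set ℂ), IsCompact K → Disjoint K (closure D) → (∀ x ∉ K, w x = u x) →
    ContinuousOn w Dᶜ → (∀ x, u x ≤ w x) → (∀ x, u x < w x → x ∈ G) →
    (∀ x, u x < w x → ViscLaplacianNonneg w x) →
    (∀ x ∈ frontier (posSet D w), x ∉ closure D → x ∉ closure (posSet D u) →
      ∀ (ν : ℂ) (α : ℝ), ‖ν‖ = 1 → BelowPlane w x ν α → √(f x) ≤ α) →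
    ∀ x, w x ≤ u x

lemma BelowPlane.mono {v w : ℂ → ℝ} {x ν : ℂ} {α : ℝ} (h : BelowPlane w x ν α)
    (hle : ∀ y, v y ≤ w y) : BelowPlane v x ν α := by
  obtain ⟨ω, h1, h2⟩ := h
  exact ⟨ω, h1, h2.mono fun y hy => (hle y).trans hy⟩

/-- The competitor is itself one of the subsolutions in the supremum defining u. Both the interior
and the free boundary conditions at points where `w` does no more than touch u are inherited from u.
-/
theorem IsLargestSubsolution.maximalOn {D : Set ℂ} {g f : ℂ → ℝ} {lam M r : ℝ} {u : ℂ → ℝ}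
    (hu : IsLargestSubsolution D g f lam M r u) (hD : IsOpen D) (h0 : (0 : ℂ) ∈ D)
    (hf : Continuous f) (hfpos : ∀ x, 0 < f x) (hr : 0 < r)
    (hR : r < outerRadius lam M r) :
    MaximalOn D f u (Metric.ball 0 (outerRadius lam M r)) := by
  intro w K hK hKD hwK hwc huw hG hvisc hfb
  have hs := hu.isSubsolution hD hf hfpos
  have hKDc : K ⊆ Dᶜ := fun x hx h => hKD.notMem_of_mem_left hx (subset_closure h)
  have hne : ∀ x ∉ D, x ≠ 0 := fun x hx h => hx (h ▸ h0)
  have hmemK : ∀ x, u x < w x → x ∈ K := fun x hx => by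
    by_contra h
    exact hx.ne (hwK x h).symm
  have hcl : ∀ x ∉ closure D, ∀ v : ℂ → ℝ, ContinuousOn v Dᶜ → ContinuousAt v x :=
    fun x hx v hv => hv.continuousAt (mem_of_superset
      (isClosed_closure.isOpen_compl.mem_nhds hx) (compl_subset_compl.2 subset_closure))
  -- Where `w` exceeds the barrier it exceeds u, hence the point is in B_{R₀} off the origin, where
  -- the barrier is harmonic; comparison applies.
  have hbar : ∀ x ∉ D, w x ≤ barrier lam M r x := by
    have hcomp := comparison hK (w := w) (H := barrier lam M r) (hwc.mono hKDc)
      (fun x hx => (continuousAt_barrier hr hR (hne x (hKDc hx))).continuousWithinAt) (by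
        intro x hx hlt
        have hux : u x < w x := (hu.le_barrier (hKDc hx)).trans_lt hlt
        have hxcl : x ∉ closure D := hKD.notMem_of_mem_left hx
        have hharm := harmonicAt_barrier hr hR (hne x (hKDc hx)) (by simpa using hG x hux)
        refine ⟨?_, hvisc x hux, hharm.1, hharm.2.self_of_nhds.le⟩
        filter_upwards [(hcl x hxcl u hu.continuousOn).eventually_lt (hcl x hxcl w hwc) hux]
          with y hy using hmemK y hy)
    intro x hx
    by_cases hxK : x ∈ K
    · exact hcomp x hxK
    · rw [hwK x hxK]; exact hu.le_barrier hx
  have hΩ : posSet D u ⊆ posSet D w := posSet_mono fun x _ => huw x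
  have hws : IsSubsolution D g f w := by
    refine ⟨hwc, fun x hx => (hs.nonneg x hx).trans (huw x), ?_, ?_, ?_⟩
    · intro x hx hxD
      rcases (huw x).lt_or_eq with hlt | heq
      · exact hvisc x hlt
      · exact (hs.subharmonic x ⟨hx.1, heq ▸ hx.2⟩ hxD).of_touching heq (Eventually.of_forall huw)
    · intro x hx
      rw [hwK x fun h => hKD.notMem_of_mem_left h hx.1]
      exact hs.le_boundary x hx
    · intro x hx hxD y s hT α hB
      by_cases hxu : x ∈ closure (posSet D u)
      · refine hs.freeBoundary x ⟨hxu, fun h => hx.2 (interior_mono hΩ h)⟩ hxD y s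
          ⟨hT.1, hT.2.1, hT.2.2.mono_right hΩ⟩ α (hB.mono huw)
      · refine hfb x hx hxD hxu _ α ?_ hB
        rw [norm_mul, ← dist_eq_norm, hT.2.1]
        simp [abs_of_pos hT.1, hT.1.ne']
  intro x
  by_cases hx : x ∈ K
  · exact (hu.isLUB x (hKDc hx)).1 ⟨w, hws, hbar, rfl⟩
  · exact (hwK x hx).le

/-- If `w` lies above a differentiable function vanishing at `x`, the slope of that function in a
unit direction bounds from below the slope of any plane above `w`. -/
lemma le_of_belowPlane {w φ : ℂ → ℝ} {x ν e : ℂ} {α : ℝ} {L : ℂ →L[ℝ] ℝ} (hν : ‖ν‖ = 1)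
    (he : ‖e‖ = 1) (hB : BelowPlane w x ν α) (hφ : HasFDerivAt φ L x) (hφx : φ x = 0)
    (hle : ∀ᶠ y in 𝓝 x, φ y ≤ w y) (hpos : 0 < L e) : L e ≤ α := by
  obtain ⟨ω, hω, hωle⟩ := hB
  -- Follow the ray x + te and divide by t; the two remainders contribute ε/2 each.
  have hkey : ∀ ε > 0, L e ≤ α * max ⟪e, ν⟫_ℝ 0 + ε := by
    intro ε hε
    have hφ' := hφ.isLittleO.def (half_pos hε)
    have hω' := hω.def (half_pos hε)
    have hlin : Tendsto (fun t : ℝ => x + t • e) (𝓝[>] 0) (𝓝 x) := by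
      have : ContinuousAt (fun t : ℝ => x + t • e) 0 := by fun_prop
      simpa [ContinuousAt] using this.tendsto.mono_left nhdsWithin_le_nhds
    obtain ⟨t, ⟨⟨⟨h1, h2⟩, h3⟩, h4⟩, ht⟩ := ((((hlin.eventually hφ').and (hlin.eventually hω')).and
      (hlin.eventually hωle)).and (hlin.eventually hle)).and self_mem_nhdsWithin |>.exists
    have ht' : 0 < t := ht
    rw [hφx] at h1
    simp only [add_sub_cancel_left, norm_smul, he, map_smul, smul_eq_mul, inner_smul_left,
      Real.norm_eq_abs, abs_of_pos ht', mul_one, sub_zero, RCLike.conj_to_real] at h1 h2 h3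
    have h5 := (abs_le.1 h1).1
    have h6 := (abs_le.1 h2).2
    have h7 : max (t * ⟪e, ν⟫_ℝ) 0 = t * max ⟪e, ν⟫_ℝ 0 := by
      rw [mul_max_of_nonneg _ _ ht'.le, mul_zero]
    rw [h7] at h3
    have h8 : t * L e ≤ t * (α * max ⟪e, ν⟫_ℝ 0 + ε) := by nlinarith
    exact le_of_mul_le_mul_left h8 ht'
  have hle' : L e ≤ α * max ⟪e, ν⟫_ℝ 0 := le_of_forall_pos_le_add hkey
  have hin : max ⟪e, ν⟫_ℝ 0 ≤ 1 := by
    refine max_le ?_ zero_le_one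
    have := real_inner_le_norm e ν
    rwa [he, hν, mul_one] at this
  have hα : 0 ≤ α := by
    by_contra! h
    nlinarith [le_max_right ⟪e, ν⟫_ℝ 0]
  exact hle'.trans (mul_le_of_le_one_right hα hin)

/-! ### Harmonic functions on disks -/

/-- On the half-radius disk the Poisson kernel lies between 1/3 and 3; compare its average against H
with the mean value at the centre. -/
lemma harnack {H : ℂ → ℝ} {c w : ℂ} {R : ℝ} (hR : 0 < R)
    (hH : InnerProductSpace.HarmonicOnNhd H (Metric.closedBall c R))
    (hpos : ∀ x ∈ Metric.sphere c R, 0 ≤ H x) (hw : ‖w - c‖ ≤ R / 2) :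
    H c ≤ 3 * H w ∧ H w ≤ 3 * H c := by
  have hwb : w ∈ Metric.ball c R := by
    rw [Metric.mem_ball, dist_eq_norm]; linarith
  have hHc : ContinuousOn H (Metric.sphere c R) :=
    hH.continuousOn.mono Metric.sphere_subset_closedBall
  have habs : |R| = R := abs_of_pos hR
  have hmean : Real.circleAverage H c R = H c :=
    InnerProductSpace.HarmonicOnNhd.circleAverage_eq (by rwa [habs])
  have hpois := InnerProductSpace.HarmonicOnNhd.circleAverage_poissonKernel_smul hH hwb
  have hkc : ContinuousOn (poissonKernel c w) (Metric.sphere c R) := by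
    have h := continuousOn_herglotzRieszKernel_sphere hwb
    rw [habs] at h
    rw [poissonKernel_eq_re_herglotzRieszKernel]
    exact Complex.continuous_re.comp_continuousOn h
  have hi1 : CircleIntegrable H c R := hHc.circleIntegrable hR.le
  have hi2 : CircleIntegrable (poissonKernel c w • H) c R :=
    (hkc.smul hHc).circleIntegrable hR.le
  have hk : ∀ x ∈ Metric.sphere c R, 1 / 3 ≤ poissonKernel c w x ∧ poissonKernel c w x ≤ 3 := by
    intro x hx
    have h1 := re_herglotzRieszKernel_le hx hwb
    have h2 := le_re_herglotzRieszKernel hx hwb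
    have h3 : poissonKernel c w x = ((x - c + (w - c)) / (x - c - (w - c))).re := by
      rw [poissonKernel_eq_re_herglotzRieszKernel]; rfl
    rw [h3]
    have hn := norm_nonneg (w - c)
    constructor
    · refine le_trans ?_ h2
      rw [div_le_div_iff₀ (by norm_num) (by linarith)]
      linarith
    · refine h1.trans ?_
      rw [div_le_iff₀ (by linarith)]
      linarith
  have h3 : Real.circleAverage ((1 / 3 : ℝ) • H) c R = 1 / 3 * H c := by
    rw [Real.circleAverage_smul, hmean, smul_eq_mul]
  have h4 : Real.circleAverage ((3 : ℝ) • H) c R = 3 * H c := by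
    rw [Real.circleAverage_smul, hmean, smul_eq_mul]
  constructor
  · have := Real.circleAverage_mono (hi1.const_smul (a := (1 / 3 : ℝ))) hi2 (by
      rw [habs]
      intro x hx
      simp only [Pi.smul_apply, Pi.smul_apply', smul_eq_mul]
      exact mul_le_mul_of_nonneg_right (hk x hx).1 (hpos x hx))
    rw [h3, hpois] at this
    linarith
  · have := Real.circleAverage_mono hi2 (hi1.const_smul (a := (3 : ℝ))) (by
      rw [habs]
      intro x hx
      simp only [Pi.smul_apply, Pi.smul_apply', smul_eq_mul]
      exact mul_le_mul_of_nonneg_right (hk x hx).2 (hpos x hx))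
    rw [h4, hpois] at this
    linarith

/-- Continuous functions on a circle are uniform limits of traces of harmonic functions. -/
lemma exists_harmonic_near_on_sphere {u : ℂ → ℝ} {c : ℂ} {R : ℝ} (hR : 0 < R)
    (hu : ContinuousOn u (Metric.sphere c R)) {ε : ℝ} (hε : 0 < ε) :
    ∃ H : ℂ → ℝ, (∀ x, InnerProductSpace.HarmonicAt H x) ∧
      ∀ x ∈ Metric.sphere c R, |u x - H x| ≤ ε := by
  set p : UnitAddCircle → ℂ := fun t => c + R * (AddCircle.toCircle t : ℂ) with hp
  have hpc : Continuous p := by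
    have : Continuous (fun t : UnitAddCircle => (AddCircle.toCircle t : ℂ)) :=
      continuous_subtype_val.comp AddCircle.continuous_toCircle
    fun_prop
  have hps : ∀ t, p t ∈ Metric.sphere c R := fun t => by
    have := Circle.norm_coe (AddCircle.toCircle t)
    simp [hp, abs_of_pos hR, this]
  let F : C(UnitAddCircle, ℂ) := ⟨fun t => (u (p t) : ℂ),
    Complex.continuous_ofReal.comp (hu.comp_continuous hpc hps)⟩
  -- Trigonometric polynomials are traces of powers of (z - c)/R and their conjugates. Real and
  -- imaginary parts are carried together so that the claim is stable under complex scalars.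
  have hspan : ∀ P ∈ Submodule.span ℂ (Set.range (@fourier 1)), ∃ H₁ H₂ : ℂ → ℝ,
      (∀ x, InnerProductSpace.HarmonicAt H₁ x) ∧ (∀ x, InnerProductSpace.HarmonicAt H₂ x) ∧
      ∀ t, (P t).re = H₁ (p t) ∧ (P t).im = H₂ (p t) := by
    intro P hP
    induction hP using Submodule.span_induction with
    | mem P hP =>
      obtain ⟨n, rfl⟩ := hP
      have han : ∀ k : ℕ, ∀ x, AnalyticAt ℂ (fun z : ℂ => ((R : ℂ)⁻¹ * (z - c)) ^ k) x := by
        intro k x; fun_prop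
      have hpow : ∀ (k : ℕ) t, ((R : ℂ)⁻¹ * (p t - c)) ^ k = (AddCircle.toCircle t : ℂ) ^ k := by
        intro k t
        have : (R : ℂ) ≠ 0 := by exact_mod_cast hR.ne'
        simp only [hp, add_sub_cancel_left]
        rw [inv_mul_cancel_left₀ this]
      obtain ⟨k, rfl | rfl⟩ := n.eq_nat_or_neg
      · refine ⟨_, _, fun x => (han k x).harmonicAt_re, fun x => (han k x).harmonicAt_im,
          fun t => ?_⟩
        have : fourier (k : ℤ) t = (AddCircle.toCircle t : ℂ) ^ k := by
          rw [fourier_apply, AddCircle.toCircle_zsmul]; simp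
        rw [this, ← hpow]; exact ⟨rfl, rfl⟩
      · refine ⟨_, _, fun x => (han k x).harmonicAt_re, fun x => (han k x).harmonicAt_im.neg,
          fun t => ?_⟩
        have : fourier (-(k : ℤ)) t = (starRingEnd ℂ) ((AddCircle.toCircle t : ℂ) ^ k) := by
          rw [fourier_neg, fourier_apply, AddCircle.toCircle_zsmul]; simp
        rw [this, ← hpow]
        exact ⟨Complex.conj_re _, Complex.conj_im _⟩
    | zero => exact ⟨0, 0, fun x => InnerProductSpace.harmonicAt_const 0,
        fun x => InnerProductSpace.harmonicAt_const 0, fun t => by simp⟩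
    | add P Q _ _ hP hQ =>
      obtain ⟨H₁, H₂, h1, h2, h3⟩ := hP
      obtain ⟨J₁, J₂, j1, j2, j3⟩ := hQ
      exact ⟨H₁ + J₁, H₂ + J₂, fun x => (h1 x).add (j1 x), fun x => (h2 x).add (j2 x),
        fun t => by simp [h3 t, j3 t]⟩
    | smul a P _ hP =>
      obtain ⟨H₁, H₂, h1, h2, h3⟩ := hP
      refine ⟨a.re • H₁ - a.im • H₂, a.re • H₂ + a.im • H₁,
        fun x => (h1 x).const_smul.sub (h2 x).const_smul,
        fun x => (h2 x).const_smul.add (h1 x).const_smul, fun t => by simp [h3 t]⟩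
  have hF : F ∈ (Submodule.span ℂ (Set.range (@fourier 1))).topologicalClosure := by
    rw [span_fourier_closure_eq_top]; trivial
  obtain ⟨P, hP, hPF⟩ := Metric.mem_closure_iff.1 hF ε hε
  obtain ⟨H, _, hH, -, hval⟩ := hspan P hP
  refine ⟨H, hH, fun x hx => ?_⟩
  obtain ⟨t, rfl⟩ : ∃ t, p t = x := by
    have hx' : ‖(x - c) / R‖ = 1 := by
      rw [mem_sphere_iff_norm] at hx
      simp [hx, abs_of_pos hR, hR.ne']
    refine ⟨((((x - c) / R).arg / (2 * Real.pi) : ℝ) : UnitAddCircle), ?_⟩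
    have hR' : (R : ℂ) ≠ 0 := by exact_mod_cast hR.ne'
    have h1 := Complex.norm_mul_exp_arg_mul_I ((x - c) / R)
    rw [hx', Complex.ofReal_one, one_mul] at h1
    simp only [hp, AddCircle.toCircle_apply_mk, Circle.coe_exp]
    have h2 : (2 * Real.pi / 1 * (((x - c) / R).arg / (2 * Real.pi)) : ℝ) = ((x - c) / R).arg := by
      field_simp
    rw [h2, h1]
    field_simp
    ring
  have h1 := (ContinuousMap.dist_apply_le_dist t).trans hPF.le
  have h2 : u (p t) - H (p t) = (F t - P t).re := by
    rw [Complex.sub_re, (hval t).1]; rfl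
  rw [h2]
  rw [dist_eq_norm] at h1
  exact (Complex.abs_re_le_norm _).trans h1

/-! ### Logarithmic bumps -/

/-- The function which is `1` on the closed disk of radius `σ` about `q`, vanishes at distance `R`
from `q` and is an affine function of `log |x - q|` outside of the disk of radius `σ`. -/
def logBump (q : ℂ) (σ R : ℝ) (x : ℂ) : ℝ :=
  (Real.log R - Real.log (max ‖x - q‖ σ)) / (Real.log R - Real.log σ)

section logBump
variable {q x : ℂ} {σ R : ℝ}

lemma logBump_denom_pos (hσ : 0 < σ) (hR : σ < R) : 0 < Real.log R - Real.log σ :=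
  sub_pos.2 (Real.log_lt_log hσ hR)

lemma continuous_logBump (hσ : 0 < σ) : Continuous (logBump q σ R) := by
  unfold logBump
  have : Continuous fun x : ℂ => Real.log (max ‖x - q‖ σ) :=
    Continuous.log (by fun_prop) fun x => (lt_max_of_lt_right hσ).ne'
  fun_prop

lemma logBump_of_le (hσ : 0 < σ) (hR : σ < R) (hx : ‖x - q‖ ≤ σ) : logBump q σ R x = 1 := by
  rw [logBump, max_eq_right hx, div_self (logBump_denom_pos hσ hR).ne']

lemma logBump_le_one (hσ : 0 < σ) (hR : σ < R) : logBump q σ R x ≤ 1 := by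
  rw [logBump, div_le_one (logBump_denom_pos hσ hR)]
  gcongr
  exact le_max_right _ _

lemma logBump_pos (hσ : 0 < σ) (hR : σ < R) (hx : ‖x - q‖ < R) : 0 < logBump q σ R x :=
  div_pos (sub_pos.2 (Real.log_lt_log (lt_max_of_lt_right hσ) (max_lt hx hR)))
    (logBump_denom_pos hσ hR)

lemma logBump_nonpos (hσ : 0 < σ) (hR : σ < R) (hx : R ≤ ‖x - q‖) : logBump q σ R x ≤ 0 := by
  refine div_nonpos_of_nonpos_of_nonneg (sub_nonpos.2 ?_) (logBump_denom_pos hσ hR).le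
  exact Real.log_le_log (hσ.trans hR) (hx.trans (le_max_left _ _))

lemma logBump_eventuallyEq (hx : σ < ‖x - q‖) : logBump q σ R =ᶠ[𝓝 x] fun y =>
    -(Real.log R - Real.log σ)⁻¹ * Real.log ‖y - q‖ +
      Real.log R * (Real.log R - Real.log σ)⁻¹ := by
  have hc : ContinuousAt (fun y : ℂ => ‖y - q‖) x := by fun_prop
  filter_upwards [hc.eventually_const_lt hx] with y hy
  rw [logBump, max_eq_left hy.le]
  ring

lemma harmonicAt_logBump (hσ : 0 < σ) (hx : σ < ‖x - q‖) :
    InnerProductSpace.HarmonicAt (logBump q σ R) x :=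
  (InnerProductSpace.harmonicAt_congr_nhds (logBump_eventuallyEq hx)).2
    (harmonicAt_log_norm_sub (by
      rintro rfl
      simp at hx
      linarith) _ _)

lemma hasFDerivAt_log_norm_sub (hx : x ≠ q) :
    HasFDerivAt (fun y : ℂ => Real.log ‖y - q‖) ((‖x - q‖ ^ 2)⁻¹ • innerSL ℝ (x - q)) x := by
  have h1 : HasFDerivAt (fun y : ℂ => ‖y - q‖ ^ 2) _ x := ((hasFDerivAt_id x).sub_const q).norm_sq
  have hne : ‖x - q‖ ^ 2 ≠ 0 := pow_ne_zero _ (norm_ne_zero_iff.2 (sub_ne_zero.2 hx))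
  have h2 := (h1.log hne).const_smul (1 / 2 : ℝ)
  have h3 : (fun y : ℂ => Real.log ‖y - q‖) = fun y => (1 / 2 : ℝ) • Real.log (‖y - q‖ ^ 2) := by
    ext y; rw [Real.log_pow]; simp
  rw [h3]
  refine h2.congr_fderiv ?_
  ext e
  simp
  ring

lemma hasFDerivAt_logBump (hσ : 0 < σ) (hx : σ < ‖x - q‖) :
    HasFDerivAt (logBump q σ R) (-(Real.log R - Real.log σ)⁻¹ •
      ((‖x - q‖ ^ 2)⁻¹ • innerSL ℝ (x - q))) x := by
  have hxq : x ≠ q := by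
    rintro rfl
    simp at hx
    linarith
  refine HasFDerivAt.congr_of_eventuallyEq ?_ (logBump_eventuallyEq hx)
  have := ((hasFDerivAt_log_norm_sub hxq).const_smul (-(Real.log R - Real.log σ)⁻¹)).add_const
    (Real.log R * (Real.log R - Real.log σ)⁻¹)
  exact this

end logBump

/-! ### Pasting competitors and locating their free boundary points -/

lemma continuousOn_ite_max {S K : Set ℂ} {u q : ℂ → ℝ} [∀ x, Decidable (x ∈ K)]
    (hu : ContinuousOn u S)
    (hK : IsClosed K) (hq : ContinuousOn q K) (hle : ∀ x ∈ frontier K, q x ≤ u x) :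
    ContinuousOn (fun x => if x ∈ K then max (u x) (q x) else u x) S := by
  refine ContinuousOn.piecewise (t := K) (f := fun x => max (u x) (q x)) (g := u) ?_ ?_ ?_
  · exact fun x hx => max_eq_left (hle x hx.2)
  · rw [hK.closure_eq]
    exact (hu.mono inter_subset_left).sup (hq.mono inter_subset_right)
  · exact hu.mono inter_subset_left

lemma IsSubsolution.continuousAt {D : Set ℂ} {g f u : ℂ → ℝ} (hs : IsSubsolution D g f u) {x : ℂ}
    (hx : x ∉ closure D) : ContinuousAt u x :=
  hs.continuousOn.continuousAt (mem_of_superset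
      (isClosed_closure.isOpen_compl.mem_nhds hx) (compl_subset_compl.2 subset_closure))

lemma mem_closure_posSet_congr {D : Set ℂ} {u w : ℂ → ℝ} {x : ℂ} (h : w =ᶠ[𝓝 x] u)
    (hx : x ∈ closure (posSet D w)) : x ∈ closure (posSet D u) := by
  rw [mem_closure_iff_frequently] at hx ⊢
  refine (hx.and_eventually h).mono ?_
  rintro y ⟨⟨h1, h2⟩, h3⟩
  exact ⟨h1, h3 ▸ h2⟩

lemma notMem_frontier_posSet {D : Set ℂ} {w : ℂ → ℝ} {x : ℂ} (hxD : x ∉ closure D)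
    (hw : ContinuousAt w x) (hpos : 0 < w x) : x ∉ frontier (posSet D w) := by
  intro h
  refine h.2 (mem_interior_iff_mem_nhds.2 ?_)
  filter_upwards [isClosed_closure.isOpen_compl.mem_nhds hxD, hw.eventually_const_lt hpos]
    with y h1 h2
  exact ⟨fun h => h1 (subset_closure h), h2⟩

lemma harmonic_nonneg_of_sphere {H : ℂ → ℝ} {c : ℂ} {r : ℝ}
    (hH : ∀ x, InnerProductSpace.HarmonicAt H x) (h : ∀ x ∈ Metric.sphere c r, 0 ≤ H x) :
    ∀ x ∈ Metric.closedBall c r, 0 ≤ H x := by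
  refine comparison (isCompact_closedBall c r) (w := fun _ => 0) continuousOn_const
    (fun x _ => (hH x).1.continuousAt.continuousWithinAt) fun x hx hlt => ?_
  refine ⟨?_, viscLaplacianNonneg_of_harmonicAt (InnerProductSpace.harmonicAt_const 0), (hH x).1,
    (hH x).2.self_of_nhds.le⟩
  refine Metric.closedBall_mem_nhds_of_mem ?_
  rw [Metric.mem_ball]
  exact lt_of_le_of_ne hx fun he => absurd (h x he) (not_le.2 hlt)

/-- Where the largest subsolution is large compared with the radius of a disk, it is harmonic in
that disk. -/
lemma exists_harmonic_approx {D G : Set ℂ} {g f u : ℂ → ℝ} (hs : IsSubsolution D g f u)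
    (hmax : MaximalOn D f u G) {Lam : ℝ} (hLam : 0 < Lam) (hf : ∀ x, f x ≤ Lam) {x₁ : ℂ} {r : ℝ}
    (hr : 0 < r) (hG : Metric.closedBall x₁ r ⊆ G)
    (hD : Disjoint (Metric.closedBall x₁ r) (closure D)) (hux : 12 * √Lam * r ≤ u x₁)
    {ε : ℝ} (hε : 0 < ε) :
    ∃ H : ℂ → ℝ, (∀ x, InnerProductSpace.HarmonicAt H x) ∧
      ∀ x ∈ Metric.closedBall x₁ r, |u x - H x| ≤ ε := by
  classical
  have hKcl : ∀ x ∈ Metric.closedBall x₁ r, x ∉ closure D := fun x hx =>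
    hD.notMem_of_mem_left hx
  have hKD : ∀ x ∈ Metric.closedBall x₁ r, x ∉ D := fun x hx h => hKcl x hx (subset_closure h)
  have hsL : 0 < √Lam := Real.sqrt_pos.2 hLam
  -- The bound √Lam·r is what the Harnack estimate for `H` can afford to lose.
  set ε' := min (ε / 2) (√Lam * r) with hε'
  have hε'0 : 0 < ε' := by positivity
  have hε'1 : ε' ≤ ε / 2 := min_le_left _ _
  have hε'2 : ε' ≤ √Lam * r := min_le_right _ _
  have huc : ContinuousOn u (Metric.closedBall x₁ r) := hs.continuousOn.mono hKD
  obtain ⟨H₀, hH₀, hH₀u⟩ := exists_harmonic_near_on_sphere hr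
    (huc.mono Metric.sphere_subset_closedBall) hε'0
  set H : ℂ → ℝ := fun x => H₀ x - ε' with hHdef
  set H' : ℂ → ℝ := fun x => H₀ x + ε' with hH'def
  have hH : ∀ x, InnerProductSpace.HarmonicAt H x := fun x =>
    (hH₀ x).sub (InnerProductSpace.harmonicAt_const ε')
  have hH' : ∀ x, InnerProductSpace.HarmonicAt H' x := fun x =>
    (hH₀ x).add (InnerProductSpace.harmonicAt_const ε')
  have hHc : Continuous H := continuous_iff_continuousAt.2 fun x => (hH x).1.continuousAt
  have hle : ∀ x ∈ Metric.sphere x₁ r, H x ≤ u x ∧ u x ≤ H' x := fun x hx => by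
    have := abs_le.1 (hH₀u x hx)
    simp only [hHdef, hH'def]
    constructor <;> linarith [this.1, this.2]
  have hnn : ∀ x ∈ Metric.closedBall x₁ r, 0 ≤ u x := fun x hx => hs.nonneg x (hKD x hx)
  have hH'nn := harmonic_nonneg_of_sphere hH' fun x hx =>
    (hnn x (Metric.sphere_subset_closedBall hx)).trans (hle x hx).2
  have hupper : ∀ x ∈ Metric.closedBall x₁ r, u x ≤ H' x := by
    refine comparison (isCompact_closedBall x₁ r) huc
      (fun x _ => (hH' x).1.continuousAt.continuousWithinAt) fun x hx hlt => ?_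
    refine ⟨?_, hs.subharmonic x ⟨hKD x hx, (hH'nn x hx).trans_lt hlt⟩ (hKcl x hx), (hH' x).1,
      (hH' x).2.self_of_nhds.le⟩
    refine Metric.closedBall_mem_nhds_of_mem ?_
    rw [Metric.mem_ball]
    exact lt_of_le_of_ne hx fun he => absurd (hle x he).2 (not_le.2 hlt)
  -- From H'(x₁) ≥ u(x₁) ≥ 12√Lam·r Harnack gives H' ≥ 4√Lam·r on the half disk, and H = H' - 2ε'
  -- loses at most 2√Lam·r.
  set m := 2 * √Lam * r with hm
  have hm0 : 0 < m := by positivity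
  have hinner : ∀ x, ‖x - x₁‖ ≤ r / 2 → m ≤ H x := by
    intro x hx
    have h1 := (harnack hr (fun x _ => hH' x)
      (fun x hx => hH'nn x (Metric.sphere_subset_closedBall hx)) hx).1
    have h2 := hupper x₁ (Metric.mem_closedBall_self hr.le)
    have h3 : H x = H' x - 2 * ε' := by simp only [hHdef, hH'def]; ring
    rw [h3, hm]
    nlinarith
  have hr2 : 0 < r / 2 := by positivity
  have hr2' : r / 2 < r := by linarith
  -- `H` alone could create free boundary inside the disk. The logarithmic bump makes the competitor
  -- positive in the whole open disk, so that new free boundary lies only on the circle, where the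
  -- slope is known. On the half disk, where the bump is not harmonic, `H` dominates it.
  set q : ℂ → ℝ := fun x => max (H x) (m * logBump x₁ (r / 2) r x) with hq
  have hbc : Continuous (logBump x₁ (r / 2) r) := continuous_logBump hr2
  have hqc : Continuous q := by fun_prop
  have hqs : ∀ x ∈ Metric.sphere x₁ r, q x ≤ u x := fun x hx => by
    refine max_le (hle x hx).1 ?_
    refine le_trans ?_ (hnn x (Metric.sphere_subset_closedBall hx))
    exact mul_nonpos_of_nonneg_of_nonpos hm0.le
      (logBump_nonpos hr2 hr2' (by rw [mem_sphere_iff_norm] at hx; exact hx.ge))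
  set w : ℂ → ℝ := fun x => if x ∈ Metric.closedBall x₁ r then max (u x) (q x) else u x with hw
  have hfr : frontier (Metric.closedBall x₁ r) ⊆ Metric.sphere x₁ r :=
    Metric.frontier_closedBall_subset_sphere
  have hwc : ContinuousOn w Dᶜ := continuousOn_ite_max hs.continuousOn Metric.isClosed_closedBall
    hqc.continuousOn fun x hx => hqs x (hfr hx)
  have hwin : ∀ x ∈ Metric.closedBall x₁ r, w x = max (u x) (q x) := fun x hx => if_pos hx
  have hwout : ∀ x ∉ Metric.closedBall x₁ r, w x = u x := fun x hx => if_neg hx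
  have huw : ∀ x, u x ≤ w x := fun x => by
    by_cases hx : x ∈ Metric.closedBall x₁ r
    · rw [hwin x hx]; exact le_max_left _ _
    · rw [hwout x hx]
  have hgt : ∀ x, u x < w x → x ∈ Metric.ball x₁ r := fun x hx => by
    have hxb : x ∈ Metric.closedBall x₁ r := by
      by_contra h; exact hx.ne (hwout x h).symm
    rw [Metric.mem_ball]
    refine lt_of_le_of_ne hxb fun he => hx.ne ?_
    rw [hwin x hxb, max_eq_left (hqs x he)]
  have hqw : ∀ x ∈ Metric.closedBall x₁ r, q x ≤ w x := fun x hx => by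
    rw [hwin x hx]; exact le_max_right _ _
  have hqpos : ∀ x ∈ Metric.ball x₁ r, 0 < q x := fun x hx =>
    lt_max_of_lt_right (mul_pos hm0 (logBump_pos hr2 hr2' (by
      rwa [Metric.mem_ball, dist_eq_norm] at hx)))
  have hconc := hmax w (Metric.closedBall x₁ r) (isCompact_closedBall _ _) hD hwout hwc huw
    (fun x hx => hG (Metric.ball_subset_closedBall (hgt x hx))) ?_ ?_
  · refine ⟨H, hH, fun x hx => ?_⟩
    have h1 := (le_max_left _ _).trans ((hqw x hx).trans (hconc x))
    have h2 := hupper x hx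
    rw [abs_le]
    simp only [hHdef, hH'def] at h1 h2 ⊢
    constructor <;> linarith
  · intro x hx
    have hxb := hgt x hx
    have hnear : ∀ᶠ y in 𝓝 x, y ∈ Metric.closedBall x₁ r :=
      mem_of_superset (Metric.isOpen_ball.mem_nhds hxb) Metric.ball_subset_closedBall
    have hwx : w x = q x := by
      rw [hwin x hnear.self_of_nhds] at hx ⊢
      exact max_eq_right ((lt_max_iff.1 hx).resolve_left (lt_irrefl _)).le
    rcases le_or_gt (m * logBump x₁ (r / 2) r x) (H x) with h | h
    · refine (viscLaplacianNonneg_of_harmonicAt (hH x)).of_touching ?_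
        (hnear.mono fun y hy => (le_max_left _ _).trans (hqw y hy))
      rw [hwx, hq]; exact (max_eq_left h).symm
    · have hxr : r / 2 < ‖x - x₁‖ := by
        by_contra! hle'
        rw [logBump_of_le hr2 hr2' hle', mul_one] at h
        exact absurd (hinner x hle') (not_le.2 h)
      refine ((viscLaplacianNonneg_of_harmonicAt (harmonicAt_logBump hr2 hxr)).const_mul
        hm0).of_touching ?_ (hnear.mono fun y hy => (le_max_right _ _).trans (hqw y hy))
      rw [hwx, hq]; exact (max_eq_right h.le).symm
  · intro x hx hxD hxu ν α hν hB
    have hwat : ContinuousAt w x := hwc.continuousAt (mem_of_superset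
      (isClosed_closure.isOpen_compl.mem_nhds hxD) (compl_subset_compl.2 subset_closure))
    have hxr : ‖x - x₁‖ = r := by
      rcases lt_trichotomy ‖x - x₁‖ r with h | h | h
      · exfalso
        have hxb : x ∈ Metric.ball x₁ r := by rwa [Metric.mem_ball, dist_eq_norm]
        exact notMem_frontier_posSet hxD hwat
          ((hqpos x hxb).trans_le (hqw x (Metric.ball_subset_closedBall hxb))) hx
      · exact h
      · exfalso
        have hev : w =ᶠ[𝓝 x] u := by
          have : x ∈ (Metric.closedBall x₁ r)ᶜ := by simpa [dist_eq_norm] using h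
          filter_upwards [Metric.isClosed_closedBall.isOpen_compl.mem_nhds this] with y hy
            using hwout y hy
        exact hxu (mem_closure_posSet_congr hev hx.1)
    have hxr2 : r / 2 < ‖x - x₁‖ := by linarith
    have hd := (hasFDerivAt_logBump (R := r) hr2 hxr2).const_smul m
    have hlog : Real.log r - Real.log (r / 2) = Real.log 2 := by
      rw [Real.log_div hr.ne' two_ne_zero]; ring
    have hl2 : 0 < Real.log 2 := Real.log_pos one_lt_two
    set e : ℂ := -((r⁻¹ : ℝ) • (x - x₁)) with he
    have he1 : ‖e‖ = 1 := by
      rw [he, norm_neg, norm_smul, hxr, Real.norm_eq_abs, abs_of_pos (inv_pos.2 hr),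
        inv_mul_cancel₀ hr.ne']
    have hval : (m • -(Real.log r - Real.log (r / 2))⁻¹ • (‖x - x₁‖ ^ 2)⁻¹ •
        innerSL ℝ (x - x₁)) e = 2 * √Lam / Real.log 2 := by
      have hin : (innerSL ℝ (x - x₁)) e = -r := by
        change ⟪x - x₁, e⟫_ℝ = -r
        rw [he, inner_neg_right, inner_smul_right, real_inner_self_eq_norm_sq, hxr]
        field_simp
      simp only [smul_apply, smul_eq_mul, hin, hlog, hxr, hm]
      field_simp
    have hpos : 0 < 2 * √Lam / Real.log 2 := by positivity
    -- The slope m/(r log 2) of the bump on the circle suffices because log 2 ≤ 1.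
    have hslope : √(f x) ≤ 2 * √Lam / Real.log 2 := by
      rw [le_div_iff₀ hl2]
      have h1 := Real.sqrt_le_sqrt (hf x)
      have h2 : Real.log 2 ≤ 1 := by linarith [Real.log_two_lt_d9]
      nlinarith [Real.sqrt_nonneg (f x)]
    refine hslope.trans ?_
    rw [← hval] at hpos ⊢
    refine le_of_belowPlane hν he1 hB hd ?_ ?_ hpos
    · simp only [Pi.smul_apply, smul_eq_mul]
      rw [logBump, max_eq_left hxr2.le, hxr, sub_self, zero_div, mul_zero]
    · filter_upwards [isClosed_closure.isOpen_compl.mem_nhds hxD] with y hy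
      by_cases hyb : y ∈ Metric.closedBall x₁ r
      · exact (le_max_right _ _).trans (hqw y hyb)
      · rw [hwout y hyb]
        refine le_trans ?_ (hs.nonneg y fun h => hy (subset_closure h))
        have : r ≤ ‖y - x₁‖ := by
          rw [Metric.mem_closedBall, dist_eq_norm] at hyb
          linarith
        exact mul_nonpos_of_nonneg_of_nonpos hm0.le (logBump_nonpos hr2 hr2' this)

/-! ### Subharmonic functions positive on a connected open set -/

/-- Ensures that the weighted supremum of bumps below is attained wherever it is positive, so that
one member touches it from below. -/
lemma exists_forall_le_of_tendsto_zero {a : ℕ → ℝ} (ha : Tendsto a atTop (𝓝 0)) {j₀ : ℕ}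
    (hj₀ : 0 < a j₀) : ∃ j, ∀ n, a n ≤ a j := by
  obtain ⟨N, hN⟩ := eventually_atTop.1 (ha.eventually_lt_const hj₀)
  obtain ⟨j, hj, hmax⟩ := Finset.exists_max_image (Finset.range (N + j₀ + 1)) a ⟨j₀, by simp⟩
  refine ⟨j, fun n => ?_⟩
  by_cases hn : n < N + j₀ + 1
  · exact hmax n (by simpa using hn)
  · exact (hN n (by omega)).le.trans (hmax j₀ (by simp))

/-- Nonnegative continuous functions bounded by `1`, vanishing outside of `E`, and subharmonic
where they are positive, except on the closed disk of radius `σ` about `q`. -/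
structure IsPartialBump (E : Set ℂ) (q : ℂ) (σ : ℝ) (ψ : ℂ → ℝ) : Prop where
  continuous : Continuous ψ
  nonneg : ∀ x, 0 ≤ ψ x
  eq_zero : ∀ x ∉ E, ψ x = 0
  le_one : ∀ x, ψ x ≤ 1
  visc : ∀ x, 0 < ψ x → σ < ‖x - q‖ → ViscLaplacianNonneg ψ x

lemma isPartialBump_logBump {E : Set ℂ} {q : ℂ} {σ R : ℝ} (hσ : 0 < σ) (hR : σ < R)
    (hE : Metric.ball q R ⊆ E) : IsPartialBump E q σ fun x => max 0 (logBump q σ R x) where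
  continuous := continuous_const.max (continuous_logBump hσ)
  nonneg x := le_max_left _ _
  eq_zero x hx := max_eq_left (logBump_nonpos hσ hR (by
    by_contra! h
    exact hx (hE (by rwa [Metric.mem_ball, dist_eq_norm]))))
  le_one x := max_le zero_le_one (logBump_le_one hσ hR)
  visc x hx hxq := by
    refine (viscLaplacianNonneg_of_harmonicAt (harmonicAt_logBump hσ hxq)).of_touching ?_
      (Eventually.of_forall fun y => le_max_right _ _)
    exact (max_eq_right ((lt_max_iff.1 hx).resolve_left (lt_irrefl _)).le).symm

/-- A new logarithmic bump centred at `x'` is scaled to stay below ψ on its plateau. The maximum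
therefore acquires no new exceptional disk. -/
lemma IsPartialBump.extend {E : Set ℂ} {q x' : ℂ} {σ ρ : ℝ} {ψ : ℂ → ℝ}
    (hψ : IsPartialBump E q σ ψ) (hx' : 0 < ψ x') (hρ : 0 < ρ) (hE : Metric.ball x' ρ ⊆ E) :
    ∃ ψ' : ℂ → ℝ, IsPartialBump E q σ ψ' ∧ ∀ x ∈ Metric.ball x' ρ, 0 < ψ' x := by
  set m := ψ x' / 2 with hm
  have hm0 : 0 < m := by positivity
  have hm1 : m ≤ 1 := by linarith [hψ.le_one x']
  obtain ⟨σ₀, hσ₀, hball⟩ := Metric.nhds_basis_closedBall.mem_iff.1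
    (hψ.continuous.continuousAt.eventually_const_lt (show m < ψ x' by linarith))
  set σ' := min σ₀ (ρ / 2) with hσ'
  have hσ'0 : 0 < σ' := by positivity
  have hσ'ρ : σ' < ρ := (min_le_right _ _).trans_lt (by linarith)
  have hin : ∀ x, ‖x - x'‖ ≤ σ' → m < ψ x := fun x hx => hball (by
    rw [Metric.mem_closedBall, dist_eq_norm]; exact hx.trans (min_le_left _ _))
  have hb := isPartialBump_logBump hσ'0 hσ'ρ hE
  refine ⟨fun x => max (ψ x) (m * max 0 (logBump x' σ' ρ x)), ⟨?_, ?_, ?_, ?_, ?_⟩, ?_⟩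
  · exact hψ.continuous.max (continuous_const.mul hb.continuous)
  · exact fun x => (hψ.nonneg x).trans (le_max_left _ _)
  · intro x hx
    simp only [hψ.eq_zero x hx, hb.eq_zero x hx, mul_zero, max_self]
  · exact fun x => max_le (hψ.le_one x) (mul_le_one₀ hm1 (hb.nonneg x) (hb.le_one x))
  · intro x hx hxq
    rcases le_or_gt (m * max 0 (logBump x' σ' ρ x)) (ψ x) with h | h
    · have hψx : 0 < ψ x := by simpa only [max_eq_left h] using hx
      exact (hψ.visc x hψx hxq).of_touching (max_eq_left h).symm
        (Eventually.of_forall fun y => le_max_left _ _)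
    · have hbx : 0 < max 0 (logBump x' σ' ρ x) :=
        pos_of_mul_pos_right ((hψ.nonneg x).trans_lt h) hm0.le
      -- On the plateau ψ > m, so the new bump is not the larger one there.
      have hxσ : σ' < ‖x - x'‖ := by
        by_contra! hle
        have h1 := hin x hle
        have h2 := hb.le_one x
        nlinarith
      exact ((hb.visc x hbx hxσ).const_mul hm0).of_touching (max_eq_right h.le).symm
        (Eventually.of_forall fun y => le_max_right _ _)
  · intro x hx
    refine lt_max_of_lt_right (mul_pos hm0 (lt_max_of_lt_right (logBump_pos hσ'0 hσ'ρ ?_)))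
    rwa [Metric.mem_ball, dist_eq_norm] at hx

/-- Connectedness: the points reached by some partial bump form an open set, and by
`IsPartialBump.extend` it is relatively closed in E. -/
lemma exists_isPartialBump_pos {E : Set ℂ} (hE : IsOpen E) (hEc : IsPreconnected E) {q : ℂ}
    {σ R : ℝ} (hσ : 0 < σ) (hR : σ < R) (hq : Metric.ball q R ⊆ E) {x : ℂ} (hx : x ∈ E) :
    ∃ ψ, IsPartialBump E q σ ψ ∧ 0 < ψ x := by
  set A : Set ℂ := {x | ∃ ψ, IsPartialBump E q σ ψ ∧ 0 < ψ x} with hA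
  suffices h : E ⊆ A from h hx
  have hqE : q ∈ E := hq (Metric.mem_ball_self (hσ.trans hR))
  refine hEc.subset_of_closure_inter_subset ?_ ⟨q, hqE, ?_⟩ ?_
  · rw [isOpen_iff_mem_nhds]
    rintro y ⟨ψ, hψ, hy⟩
    filter_upwards [hψ.continuous.continuousAt.eventually_const_lt hy] with z hz
    exact ⟨ψ, hψ, hz⟩
  · exact ⟨_, isPartialBump_logBump hσ hR hq,
      lt_max_of_lt_right (logBump_pos hσ hR (by simpa using hσ.trans hR))⟩
  · rintro y ⟨hyA, hyE⟩
    obtain ⟨ε, hε, hball⟩ := Metric.isOpen_iff.1 hE y hyE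
    obtain ⟨x', ⟨ψ, hψ, hx'⟩, hdist⟩ := Metric.mem_closure_iff.1 hyA (ε / 2) (by positivity)
    obtain ⟨ψ', hψ', hpos⟩ := hψ.extend hx' (half_pos hε) (fun z hz => hball (by
      rw [Metric.mem_ball] at hz ⊢
      have := dist_triangle z x' y
      rw [dist_comm x' y] at this
      linarith))
    exact ⟨ψ', hψ', hpos y (by rwa [Metric.mem_ball])⟩

/-- Countably many partial bumps have positivity sets covering E. A supremum is taken instead of a
sum because viscosity subharmonicity then follows by touching. -/
lemma exists_isPartialBump_forall_pos {E : Set ℂ} (hE : IsOpen E) (hEc : IsPreconnected E) {q : ℂ}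
    {σ R : ℝ} (hσ : 0 < σ) (hR : σ < R) (hq : Metric.ball q R ⊆ E) :
    ∃ ψ, IsPartialBump E q σ ψ ∧ ∀ x ∈ E, 0 < ψ x := by
  have hqE : q ∈ E := hq (Metric.mem_ball_self (hσ.trans hR))
  have hch : ∀ x, ∃ ψ, IsPartialBump E q σ ψ ∧ (x ∈ E → 0 < ψ x) := fun x => by
    by_cases hx : x ∈ E
    · obtain ⟨ψ, h1, h2⟩ := exists_isPartialBump_pos hE hEc hσ hR hq hx
      exact ⟨ψ, h1, fun _ => h2⟩
    · exact ⟨_, isPartialBump_logBump hσ hR hq, fun h => absurd h hx⟩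
  choose Ψ hΨ hΨpos using hch
  obtain ⟨t, htc, htE, hcov⟩ := (HereditarilyLindelofSpace.isLindelof E).elim_nhds_subcover
    (fun x => {y | 0 < Ψ x y})
    (fun x hx => (hΨ x).continuous.continuousAt.eventually_const_lt (hΨpos x hx))
  have htne : t.Nonempty := by
    obtain ⟨x, hx, -⟩ := mem_iUnion₂.1 (hcov hqE)
    exact ⟨x, hx⟩
  obtain ⟨e, rfl⟩ := htc.exists_eq_range htne
  -- The weights 2⁻ʲ give uniform convergence of the finite maxima, hence continuity, and make the
  -- supremum attained.
  set a : ℂ → ℕ → ℝ := fun x j => (1 / 2 : ℝ) ^ j * Ψ (e j) x with ha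
  have ha0 : ∀ x j, 0 ≤ a x j := fun x j => mul_nonneg (by positivity) ((hΨ _).nonneg x)
  have hale : ∀ x j, a x j ≤ (1 / 2 : ℝ) ^ j := fun x j =>
    mul_le_of_le_one_right (by positivity) ((hΨ _).le_one x)
  have ha1 : ∀ x j, a x j ≤ 1 := fun x j =>
    (hale x j).trans (pow_le_one₀ (by norm_num) (by norm_num))
  have hbdd : ∀ x, BddAbove (range (a x)) := fun x => ⟨1, by rintro _ ⟨j, rfl⟩; exact ha1 x j⟩
  have hlim : ∀ x, Tendsto (a x) atTop (𝓝 0) := fun x =>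
    squeeze_zero (ha0 x) (hale x) (tendsto_pow_atTop_nhds_zero_of_lt_one (by norm_num)
      (by norm_num))
  set ψ : ℂ → ℝ := fun x => ⨆ j, a x j with hψ
  have hle : ∀ x j, a x j ≤ ψ x := fun x j => le_ciSup (hbdd x) j
  have hnn : ∀ x, 0 ≤ ψ x := fun x => (ha0 x 0).trans (hle x 0)
  refine ⟨ψ, ⟨?_, hnn, ?_, fun x => ciSup_le (ha1 x), ?_⟩, ?_⟩
  · set F : ℕ → ℂ → ℝ := fun n x => (Finset.range (n + 1)).sup' ⟨0, by simp⟩ (a x) with hF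
    have hFc : ∀ n, Continuous (F n) := fun n =>
      Continuous.finset_sup'_apply _ fun j _ => continuous_const.mul (hΨ (e j)).continuous
    have hFψ : ∀ n x, F n x ≤ ψ x := fun n x => Finset.sup'_le _ _ fun j _ => hle x j
    have hψF : ∀ n x, ψ x ≤ F n x + (1 / 2 : ℝ) ^ n := by
      intro n x
      refine ciSup_le fun j => ?_
      by_cases hj : j < n + 1
      · have := Finset.le_sup' (a x) (Finset.mem_range.2 hj)
        have h2 : 0 ≤ (1 / 2 : ℝ) ^ n := by positivity
        simp only [hF]
        linarith
      · have h1 : (0 : ℝ) ≤ F n x :=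
          (ha0 x 0).trans (Finset.le_sup' (a x) (Finset.mem_range.2 (Nat.succ_pos n)))
        have h2 : (1 / 2 : ℝ) ^ j ≤ (1 / 2 : ℝ) ^ n :=
          pow_le_pow_of_le_one (by norm_num) (by norm_num) (by omega)
        linarith [hale x j]
    have hunif : TendstoUniformly F ψ atTop := by
      rw [Metric.tendstoUniformly_iff]
      intro ε hε
      have : Tendsto (fun n : ℕ => (1 / 2 : ℝ) ^ n) atTop (𝓝 0) :=
        tendsto_pow_atTop_nhds_zero_of_lt_one (by norm_num) (by norm_num)
      filter_upwards [this.eventually_lt_const hε] with n hn x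
      rw [Real.dist_eq, abs_of_nonneg (sub_nonneg.2 (hFψ n x))]
      linarith [hψF n x]
    exact hunif.continuous (Frequently.of_forall hFc)
  · intro x hx
    have : ∀ j, a x j = 0 := fun j => by simp only [ha, (hΨ (e j)).eq_zero x hx, mul_zero]
    simp only [hψ, this, ciSup_const]
  · intro x hx hxq
    obtain ⟨j₀, hj₀⟩ := exists_lt_of_lt_ciSup hx
    obtain ⟨j, hj⟩ := exists_forall_le_of_tendsto_zero (hlim x) hj₀
    have hψx : a x j = ψ x := le_antisymm (hle x j) (ciSup_le hj)
    have hpos : 0 < Ψ (e j) x := by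
      have : 0 < a x j := hψx ▸ hx
      exact pos_of_mul_pos_right this (by positivity)
    exact (((hΨ (e j)).visc x hpos hxq).const_mul (pow_pos (by norm_num : (0 : ℝ) < 1 / 2)
      j)).of_touching hψx (Eventually.of_forall fun y => hle y j)
  · intro x hx
    obtain ⟨y, ⟨j, rfl⟩, hy⟩ := mem_iUnion₂.1 (hcov hx)
    exact (mul_pos (by positivity) hy).trans_le (hle x j)

/-! ### Propagation of flatness -/

lemma harmonicAt_affine (p k : ℂ) (A B : ℝ) (x : ℂ) :
    InnerProductSpace.HarmonicAt (fun y => A * ((y - p) / k).re + B) x := by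
  have h : AnalyticAt ℂ (fun y : ℂ => (A : ℂ) * ((y - p) / k) + (B : ℂ)) x := by
    simp only [div_eq_mul_inv]
    fun_prop
  have h2 := h.harmonicAt_re
  have : (fun y => ((A : ℂ) * ((y - p) / k) + (B : ℂ)).re) =
      fun y => A * ((y - p) / k).re + B := by
    ext y
    rw [Complex.add_re, Complex.re_ofReal_mul, Complex.ofReal_re]
  rw [← this]
  exact h2

/-- Harnack's inequality for the distance between `u` and a harmonic function above `u`. -/
lemma sub_le_three_mul {D G : Set ℂ} {g f u : ℂ → ℝ} (hs : IsSubsolution D g f u)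
    (hmax : MaximalOn D f u G) {Lam : ℝ} (hLam : 0 < Lam) (hf : ∀ x, f x ≤ Lam) {x₁ : ℂ} {r : ℝ}
    (hr : 0 < r) (hG : Metric.closedBall x₁ r ⊆ G)
    (hD : Disjoint (Metric.closedBall x₁ r) (closure D)) (hux : 12 * √Lam * r ≤ u x₁)
    {L : ℂ → ℝ} (hL : ∀ x, InnerProductSpace.HarmonicAt L x)
    (huL : ∀ x ∈ Metric.closedBall x₁ r, u x ≤ L x) {y : ℂ} (hy : ‖y - x₁‖ ≤ r / 2) :
    L y - u y ≤ 3 * (L x₁ - u x₁) := by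
  -- Harnack is applied to L - H + ε/6, nonnegative on the circle; the approximation errors add up
  -- to exactly ε.
  refine le_of_forall_pos_le_add fun ε hε => ?_
  obtain ⟨H, hH, hHu⟩ := exists_harmonic_approx hs hmax hLam hf hr hG hD hux
    (show 0 < ε / 6 by positivity)
  have hJ : ∀ x, InnerProductSpace.HarmonicAt (fun x => L x - H x + ε / 6) x := fun x =>
    ((hL x).sub (hH x)).add (InnerProductSpace.harmonicAt_const (ε / 6))
  have h1 := (harnack hr (fun x _ => hJ x) (fun x hx => by
    have hx' := Metric.sphere_subset_closedBall hx
    have h2 := huL x hx'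
    have h3 := (abs_le.1 (hHu x hx')).1
    linarith) hy).2
  have hyb : y ∈ Metric.closedBall x₁ r := by
    rw [Metric.mem_closedBall, dist_eq_norm]; linarith
  have h2 := (abs_le.1 (hHu y hyb)).1
  have h3 := (abs_le.1 (hHu x₁ (Metric.mem_closedBall_self hr.le))).2
  linarith

/-- The gap between the upper plane L and u is of order δ at ζ = 2. Joining that point to x by a
segment in T ≥ 1 + τ, each Harnack step multiplies the gap by at most 3. The number of steps depends
only on a, Lam and τ, so a small δ wins. -/
lemma flat_lower_bound {a Lam τ κ : ℝ} (ha : 0 < a) (hLam : 0 < Lam) (hτ : 0 < τ) (hτ1 : τ ≤ 1)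
    (hκ : 0 < κ) : ∃ δ₀ > 0, ∀ δ, 0 < δ → δ ≤ δ₀ → ∀ {D G : Set ℂ} {g f u : ℂ → ℝ},
      IsSubsolution D g f u → MaximalOn D f u G → (∀ x, f x ≤ Lam) → ∀ p k : ℂ, k ≠ 0 →
      Metric.closedBall p (20 * ‖k‖) ⊆ G → Disjoint (Metric.closedBall p (20 * ‖k‖)) (closure D) →
      (∀ x, ‖(x - p) / k‖ ≤ 20 → 1 ≤ ((x - p) / k).re →
        u x ≤ ‖k‖ * ((a + δ) * (((x - p) / k).re - 1 + δ))) →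
      ‖k‖ * (a - δ) ≤ u (p + 2 * k) →
      ∀ x, ‖(x - p) / k‖ ≤ 10 → 1 + τ ≤ ((x - p) / k).re →
        ‖k‖ * ((a - κ) * (((x - p) / k).re - 1)) ≤ u x := by
  have hsL : 0 < √Lam := Real.sqrt_pos.2 hLam
  -- Step disks of radius c (in ζ) stay in T ≥ 1 as c ≤ τ, and 12√Lam·c ≤ aτ/2 is the size of u
  -- needed for approximate harmonicity.
  set c := min τ (a * τ / (24 * √Lam)) with hc
  have hc0 : 0 < c := by positivity
  have hcτ : c ≤ τ := min_le_left _ _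
  have hcL : 12 * √Lam * c ≤ a * τ / 2 := by
    have : c ≤ a * τ / (24 * √Lam) := min_le_right _ _
    rw [le_div_iff₀ (by positivity)] at this
    linarith
  -- The segment has length at most 12 in ζ, and each step must be at most c/2.
  obtain ⟨N, hN⟩ := exists_nat_gt (24 / c)
  have hN0 : (0 : ℝ) < N := lt_trans (by positivity) hN
  -- A gap below aτ/2 keeps u large enough to continue the chain; a gap below κτ ≤ κ(T - 1) is the
  -- final accuracy.
  set θ := min (a * τ / 2) (κ * τ) with hθ
  have hθ0 : 0 < θ := by positivity
  refine ⟨min 1 (θ / (3 ^ N * (a + 3))), by positivity, ?_⟩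
  intro δ hδ hδ₀ D G g f u hs hmax hf p k hk hG hD hup hlow x hx hxT
  have hδ1 : δ ≤ 1 := hδ₀.trans (min_le_left _ _)
  have hδθ : 3 ^ N * ((a + 3) * δ) ≤ θ := by
    have : δ ≤ θ / (3 ^ N * (a + 3)) := hδ₀.trans (min_le_right _ _)
    rw [le_div_iff₀ (by positivity)] at this
    linarith
  have hk0 : 0 < ‖k‖ := norm_pos_iff.2 hk
  set ζ : ℂ → ℂ := fun x => (x - p) / k with hζ
  have hζsub : ∀ x y, ζ x - ζ y = (x - y) / k := fun x y => by simp only [hζ]; ring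
  have hζnorm : ∀ x, ‖x - p‖ = ‖ζ x‖ * ‖k‖ := fun x => by
    simp only [hζ, norm_div]; field_simp
  set L : ℂ → ℝ := fun x => ‖k‖ * ((a + δ) * ((ζ x).re - 1 + δ)) with hL
  have hLh : ∀ x, InnerProductSpace.HarmonicAt L x := fun x => by
    have : L = fun y => (‖k‖ * (a + δ)) * ((y - p) / k).re + ‖k‖ * (a + δ) * (δ - 1) := by
      ext y; simp only [hL, hζ]; ring
    rw [this]
    exact harmonicAt_affine p k _ _ x
  -- one step of the Harnack chain
  have hstep : ∀ y y', ‖ζ y‖ ≤ 10 → 1 + τ ≤ (ζ y).re → L y - u y ≤ ‖k‖ * θ →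
      ‖ζ y' - ζ y‖ ≤ c / 2 → L y' - u y' ≤ 3 * (L y - u y) := by
    intro y y' hy hyT hW hyy'
    have hball : ∀ z ∈ Metric.closedBall y (c * ‖k‖), ‖ζ z‖ ≤ 11 ∧ 1 ≤ (ζ z).re := by
      intro z hz
      rw [Metric.mem_closedBall, dist_eq_norm] at hz
      have h1 : ‖ζ z - ζ y‖ ≤ c := by
        rw [hζsub, norm_div, div_le_iff₀ hk0]; exact hz
      constructor
      · have := norm_add_le (ζ y) (ζ z - ζ y)
        rw [add_sub_cancel] at this
        linarith
      · have := (abs_le.1 ((Complex.abs_re_le_norm _).trans h1)).1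
        rw [Complex.sub_re] at this
        linarith
    have hsub : Metric.closedBall y (c * ‖k‖) ⊆ Metric.closedBall p (20 * ‖k‖) := by
      intro z hz
      rw [Metric.mem_closedBall, dist_eq_norm, hζnorm]
      have := (hball z hz).1
      gcongr
      linarith
    refine sub_le_three_mul hs hmax hLam hf (r := c * ‖k‖) (by positivity) (hsub.trans hG)
      (hD.mono_left hsub) ?_ hLh (fun z hz => ?_) ?_
    · have h1 : θ ≤ a * τ / 2 := min_le_left _ _
      have h2 : ‖k‖ * (a * τ) ≤ L y := by
        simp only [hL]
        gcongr <;> linarith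
      have h3 : ‖k‖ * θ ≤ ‖k‖ * (a * τ / 2) := by gcongr
      have h4 : ‖k‖ * (12 * √Lam * c) ≤ ‖k‖ * (a * τ / 2) := by gcongr
      linarith
    · exact hup z ((hball z hz).1.trans (by norm_num)) (hball z hz).2
    · have : ‖y' - y‖ = ‖ζ y' - ζ y‖ * ‖k‖ := by
        rw [hζsub, norm_div]; field_simp
      rw [this]
      calc ‖ζ y' - ζ y‖ * ‖k‖ ≤ c / 2 * ‖k‖ := by gcongr
        _ = c * ‖k‖ / 2 := by ring
  set P : ℕ → ℂ := fun i => (p + 2 * k) + ((i : ℝ) / N) • (x - (p + 2 * k)) with hP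
  have hζ0 : ζ (p + 2 * k) = 2 := by simp only [hζ]; field_simp; ring
  have hζP : ∀ i, ζ (P i) = 2 + ((i : ℝ) / N) • (ζ x - 2) := by
    intro i
    simp only [hζ, hP, Complex.real_smul]
    field_simp
    ring
  have hPin : ∀ i, i ≤ N → ‖ζ (P i)‖ ≤ 10 ∧ 1 + τ ≤ (ζ (P i)).re := by
    intro i hi
    have ht0 : 0 ≤ (i : ℝ) / N := by positivity
    have ht1 : (i : ℝ) / N ≤ 1 := (div_le_one hN0).2 (by exact_mod_cast hi)
    rw [hζP]
    set t := (i : ℝ) / N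
    have e : (2 : ℂ) + t • (ζ x - 2) = (1 - t) • (2 : ℂ) + t • ζ x := by
      simp only [Complex.real_smul, Complex.ofReal_sub, Complex.ofReal_one]; ring
    rw [e]
    constructor
    · refine (norm_add_le _ _).trans ?_
      rw [norm_smul, norm_smul, Real.norm_of_nonneg ht0, Real.norm_of_nonneg (sub_nonneg.2 ht1)]
      have h2 : ‖(2 : ℂ)‖ = 2 := by simp
      rw [h2]
      have : t * ‖ζ x‖ ≤ t * 10 := by gcongr
      linarith
    · simp only [Complex.add_re, Complex.real_smul, Complex.re_ofReal_mul]
      have h2 : (2 : ℂ).re = 2 := rfl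
      rw [h2]
      have : t * (1 + τ) ≤ t * (ζ x).re := by gcongr
      nlinarith
  have hPstep : ∀ i, ‖ζ (P (i + 1)) - ζ (P i)‖ ≤ c / 2 := by
    intro i
    have e : ζ (P (i + 1)) - ζ (P i) = (1 / (N : ℝ)) • (ζ x - 2) := by
      rw [hζP, hζP]
      simp only [Complex.real_smul]
      push_cast
      field_simp
      ring
    rw [e, norm_smul, Real.norm_of_nonneg (by positivity)]
    have h1 : ‖ζ x - 2‖ ≤ 12 := by
      refine (norm_sub_le _ _).trans ?_
      have h2 : ‖(2 : ℂ)‖ = 2 := by simp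
      rw [h2]; linarith
    rw [div_lt_iff₀ hc0] at hN
    rw [one_div, inv_mul_le_iff₀ hN0]
    linarith
  have hind : ∀ i, i ≤ N → L (P i) - u (P i) ≤ 3 ^ i * (‖k‖ * ((a + 3) * δ)) := by
    intro i
    induction i with
    | zero =>
      intro _
      have hP0 : P 0 = p + 2 * k := by simp [hP]
      rw [hP0]
      have h2 : (2 : ℂ).re = 2 := rfl
      simp only [hL, hζ0, h2, pow_zero, one_mul]
      have : ‖k‖ * ((a + δ) * (2 - 1 + δ)) - ‖k‖ * (a - δ) ≤ ‖k‖ * ((a + 3) * δ) := by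
        rw [← mul_sub]
        gcongr
        nlinarith
      linarith
    | succ i ih =>
      intro hi
      have ih' := ih (by omega)
      have hb := hPin i (by omega)
      have hW : L (P i) - u (P i) ≤ ‖k‖ * θ := by
        refine ih'.trans ?_
        have h3 : (3 : ℝ) ^ i ≤ 3 ^ N := pow_le_pow_right₀ (by norm_num) (by omega)
        calc (3 : ℝ) ^ i * (‖k‖ * ((a + 3) * δ)) ≤ 3 ^ N * (‖k‖ * ((a + 3) * δ)) := by gcongr
          _ = ‖k‖ * (3 ^ N * ((a + 3) * δ)) := by ring
          _ ≤ ‖k‖ * θ := by gcongr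
      refine (hstep (P i) (P (i + 1)) hb.1 hb.2 hW (hPstep i)).trans ?_
      rw [pow_succ]
      linarith
  have hPN : P N = x := by
    simp only [hP, div_self hN0.ne', one_smul]; ring
  have hfin := hind N le_rfl
  rw [hPN] at hfin
  have h1 : (3 : ℝ) ^ N * (‖k‖ * ((a + 3) * δ)) ≤ ‖k‖ * (κ * τ) := by
    calc (3 : ℝ) ^ N * (‖k‖ * ((a + 3) * δ)) = ‖k‖ * (3 ^ N * ((a + 3) * δ)) := by ring
      _ ≤ ‖k‖ * θ := by gcongr
      _ ≤ ‖k‖ * (κ * τ) := by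
        gcongr
        exact min_le_right _ _
  have hxT' : 1 + τ ≤ (ζ x).re := hxT
  have h2 : ‖k‖ * (a * ((ζ x).re - 1)) ≤ L x := by
    simp only [hL]
    have : 0 ≤ (ζ x).re - 1 := by linarith
    gcongr <;> linarith
  have h3 : ‖k‖ * (κ * τ) ≤ ‖k‖ * (κ * ((ζ x).re - 1)) := by gcongr; linarith
  change ‖k‖ * ((a - κ) * ((ζ x).re - 1)) ≤ u x
  nlinarith

/-! ### The lifted half plane -/

/-- The harmonic function `a' (T - 1) + η (Re (1 / ζ) - 1 / 4)`, where `T = Re ζ`,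
`a' = 159 a / 160` and `η = a / 8`. It is a plane vanishing on `T = 1`, lifted inside of the disk
`|ζ - 2| < 2`. -/
def liftedPlane (a : ℝ) (ζ : ℂ) : ℝ :=
  (((159 / 160 * a : ℝ) : ℂ) * (ζ - 1) + ((a / 8 : ℝ) : ℂ) * (ζ⁻¹ - 1 / 4)).re

lemma liftedPlane_eq (a : ℝ) (ζ : ℂ) : liftedPlane a ζ =
    159 / 160 * a * (ζ.re - 1) + a / 8 * (ζ.re / (ζ.re ^ 2 + ζ.im ^ 2) - 1 / 4) := by
  have h : (1 / 4 : ℂ).re = 1 / 4 := by norm_num [Complex.div_re]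
  rw [liftedPlane, Complex.add_re, Complex.re_ofReal_mul, Complex.re_ofReal_mul, Complex.sub_re,
    Complex.sub_re, Complex.inv_re, Complex.normSq_apply, Complex.one_re, h]
  ring

lemma norm_sq_eq_re_im (ζ : ℂ) : ‖ζ‖ ^ 2 = ζ.re ^ 2 + ζ.im ^ 2 := by
  rw [← Complex.normSq_eq_norm_sq, Complex.normSq_apply]; ring

lemma norm_sub_four_sq (ζ : ℂ) : ‖ζ - 4‖ ^ 2 = ζ.re ^ 2 + ζ.im ^ 2 - 8 * ζ.re + 16 := by
  rw [norm_sq_eq_re_im]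
  have h1 : (4 : ℂ).re = 4 := rfl
  have h2 : (4 : ℂ).im = 0 := rfl
  rw [Complex.sub_re, Complex.sub_im, h1, h2]
  ring

lemma liftedPlane_neg_of_norm_eq_half {a : ℝ} (ha : 0 < a) {ζ : ℂ} (h : ‖ζ‖ = 1 / 2) :
    liftedPlane a ζ < 0 := by
  rw [liftedPlane_eq, ← norm_sq_eq_re_im, h]
  have := (Complex.re_le_norm ζ).trans h.le
  have e : 159 / 160 * a * (ζ.re - 1) + a / 8 * (ζ.re / (1 / 2) ^ 2 - 1 / 4) =
      a * (159 / 160 * (ζ.re - 1) + 1 / 8 * (4 * ζ.re - 1 / 4)) := by ring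
  rw [e]
  exact mul_neg_of_pos_of_neg ha (by linarith)

/-- Inversion maps this circle to the line Re (1/ζ) = 1/8, so the extra term equals (a/8)(1/8 - 1/4)
= -a/64: the plane is lowered there. -/
lemma liftedPlane_of_norm_sub_four_eq {a : ℝ} {ζ : ℂ} (h : ‖ζ - 4‖ = 4)
    (h0 : 1 / 2 ≤ ‖ζ‖) : liftedPlane a ζ = 159 / 160 * a * (ζ.re - 1) - a / 64 := by
  have h1 := norm_sub_four_sq ζ
  rw [h] at h1
  have h2 : ζ.re ^ 2 + ζ.im ^ 2 = 8 * ζ.re := by linarith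
  have h3 : 0 < ζ.re := by
    have := norm_sq_eq_re_im ζ
    nlinarith
  rw [liftedPlane_eq, h2]
  field_simp
  ring

/-- On this disk, behind the line T = 1 and towards the pole, the lift beats the negative plane. It
is the exceptional disk of the filling. -/
lemma liftedPlane_lower {a : ℝ} (ha : 0 < a) {ζ : ℂ} (h : ‖ζ - (19 / 20 : ℝ)‖ ≤ 1 / 50) :
    a / 50 ≤ liftedPlane a ζ ∧ ‖ζ - 4‖ < 4 ∧ 1 / 2 < ‖ζ‖ ∧ ζ.re ≤ 97 / 100 := by
  have hre := abs_le.1 ((Complex.abs_re_le_norm _).trans h)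
  rw [Complex.sub_re, Complex.ofReal_re] at hre
  have hn : ‖ζ‖ ≤ 97 / 100 := by
    have := norm_add_le (ζ - (19 / 20 : ℝ)) ((19 / 20 : ℝ) : ℂ)
    rw [sub_add_cancel, Complex.norm_real, Real.norm_of_nonneg (by norm_num)] at this
    linarith
  have hn2 : 93 / 100 ≤ ‖ζ‖ := le_trans (by linarith [hre.1]) (Complex.re_le_norm ζ)
  have hsq := norm_sq_eq_re_im ζ
  have hsq2 : ‖ζ‖ ^ 2 ≤ (97 / 100) ^ 2 := by gcongr
  refine ⟨?_, ?_, by linarith, by linarith [hre.2]⟩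
  · rw [liftedPlane_eq, ← hsq]
    have h1 : 98 / 100 ≤ ζ.re / ‖ζ‖ ^ 2 := by
      rw [le_div_iff₀ (by positivity)]
      nlinarith [hre.1]
    nlinarith [hre.1]
  · have := norm_sub_four_sq ζ
    nlinarith [norm_nonneg (ζ - 4)]

/-- Zeros near T = 1 have Re (1/ζ) ≈ 1/4, hence |ζ|² ≈ 4 and Re ζ² ≈ -2, so the T-derivative -Re
(1/ζ²) is about 1/8. Already 1/10 suffices: 159/160 + (1/8)(1/10) = 161/160. -/
lemma liftedPlane_slope {a : ℝ} (ha : 0 < a) {ζ : ℂ} (h0 : liftedPlane a ζ = 0)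
    (h1 : 999 / 1000 ≤ ζ.re) (h2 : ζ.re ≤ 1001 / 1000) :
    161 / 160 * a ≤
      (((159 / 160 * a : ℝ) : ℂ) + ((a / 8 : ℝ) : ℂ) * (-(ζ ^ 2)⁻¹)).re := by
  have hN0 : 0 < ζ.re ^ 2 + ζ.im ^ 2 := by nlinarith
  set N := ζ.re ^ 2 + ζ.im ^ 2 with hN
  have hre : (-(ζ ^ 2)⁻¹).re = (N - 2 * ζ.re ^ 2) / N ^ 2 := by
    rw [Complex.neg_re, Complex.inv_re, Complex.normSq_eq_norm_sq, norm_pow, norm_sq_eq_re_im, ← hN]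
    have : (ζ ^ 2).re = ζ.re ^ 2 - ζ.im ^ 2 := by rw [pow_two, Complex.mul_re]; ring
    rw [this, ← neg_div]
    congr 1
    rw [hN]; ring
  rw [Complex.add_re, Complex.re_ofReal_mul, Complex.ofReal_re, hre]
  rw [liftedPlane_eq, ← hN] at h0
  have h3 : ζ.re / N - 1 / 4 = -(159 / 20) * (ζ.re - 1) := by
    have : a * (159 / 160 * (ζ.re - 1) + 1 / 8 * (ζ.re / N - 1 / 4)) = 0 := by linarith
    have := (mul_eq_zero.1 this).resolve_left ha.ne'
    linarith
  have h4 : ζ.re = (1 / 4 - 159 / 20 * (ζ.re - 1)) * N := by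
    have : ζ.re / N = 1 / 4 - 159 / 20 * (ζ.re - 1) := by linarith
    rw [← this]; field_simp
  have h5 : 387 / 100 ≤ N := by nlinarith
  have h6 : N ≤ 414 / 100 := by nlinarith
  have h7 : 1 / 10 ≤ (N - 2 * ζ.re ^ 2) / N ^ 2 := by
    rw [le_div_iff₀ (by positivity)]
    nlinarith
  nlinarith

lemma analyticAt_liftedPlane_aux (a : ℝ) {ζ : ℂ} (hζ : ζ ≠ 0) :
    HasDerivAt (fun ζ : ℂ => ((159 / 160 * a : ℝ) : ℂ) * (ζ - 1) + ((a / 8 : ℝ) : ℂ) * (ζ⁻¹ - 1 / 4))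
      (((159 / 160 * a : ℝ) : ℂ) + ((a / 8 : ℝ) : ℂ) * (-(ζ ^ 2)⁻¹)) ζ := by
  have h1 := (((hasDerivAt_id ζ).sub_const 1).const_mul ((159 / 160 * a : ℝ) : ℂ)).add
    (((hasDerivAt_inv hζ).sub_const (1 / 4)).const_mul ((a / 8 : ℝ) : ℂ))
  exact h1.congr_deriv (by rw [mul_one])

lemma harmonicAt_liftedPlane (a : ℝ) {p k x : ℂ} (hx : (x - p) / k ≠ 0) :
    InnerProductSpace.HarmonicAt (fun y => ‖k‖ * liftedPlane a ((y - p) / k)) x := by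
  have h0 : AnalyticAt ℂ (fun y : ℂ => (y - p) / k) x := by
    simp only [div_eq_mul_inv]; fun_prop
  have h1 : AnalyticAt ℂ (fun y : ℂ => ((159 / 160 * a : ℝ) : ℂ) * ((y - p) / k - 1) +
      ((a / 8 : ℝ) : ℂ) * (((y - p) / k)⁻¹ - 1 / 4)) x := by
    have := h0.inv hx
    fun_prop
  exact h1.harmonicAt_re.const_smul (c := ‖k‖)

lemma hasFDerivAt_liftedPlane (a : ℝ) {p k x : ℂ} (hk : k ≠ 0) (hx : (x - p) / k ≠ 0) :
    ∃ L : ℂ →L[ℝ] ℝ, HasFDerivAt (fun y => ‖k‖ * liftedPlane a ((y - p) / k)) L x ∧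
      L (k / ‖k‖) = (((159 / 160 * a : ℝ) : ℂ) +
        ((a / 8 : ℝ) : ℂ) * (-(((x - p) / k) ^ 2)⁻¹)).re := by
  have h0 : HasDerivAt (fun y : ℂ => (y - p) / k) (1 / k) x :=
    ((hasDerivAt_id x).sub_const p).div_const k
  have h1 := ((analyticAt_liftedPlane_aux a hx).comp x h0).hasFDerivAt.restrictScalars ℝ
  have h2 := (Complex.reCLM.hasFDerivAt.comp x h1).const_smul ‖k‖
  refine ⟨_, h2, ?_⟩
  have hk' : (‖k‖ : ℂ) ≠ 0 := by exact_mod_cast (norm_pos_iff.2 hk).ne'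
  simp only [smul_apply, ContinuousLinearMap.comp_apply, Complex.reCLM_apply, smul_eq_mul,
    ContinuousLinearMap.coe_restrictScalars', ContinuousLinearMap.toSpanSingleton_apply]
  rw [← Complex.re_ofReal_mul]
  congr 1
  field_simp

/-! ### The competitor -/

theorem false_of_flat_component {D G E : Set ℂ} {g f u : ℂ → ℝ} (hs : IsSubsolution D g f u)
    (hmax : MaximalOn D f u G) (hE : IsOpen E) (hEc : IsPreconnected E)
    (hEb : Bornology.IsBounded E) (hED : Disjoint (closure E) (closure D)) (hEG : E ⊆ G)
    (hEu : ∀ x ∈ E, u x = 0) (hEfr : frontier E ⊆ closure (posSet D u))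
    {a : ℝ} (ha : 0 < a) {p k : ℂ} (hk : k ≠ 0) (hG : Metric.closedBall p (20 * ‖k‖) ⊆ G)
    (hD : Disjoint (Metric.closedBall p (20 * ‖k‖)) (closure D))
    (hkE : ∀ x, ‖(x - p) / k‖ ≤ 20 → ((x - p) / k).re ≤ 999 / 1000 → x ∈ E)
    (hf : ∀ x ∈ Metric.closedBall p (20 * ‖k‖), √(f x) ≤ 161 / 160 * a)
    (hlow : ∀ x, ‖(x - p) / k‖ ≤ 10 → 1001 / 1000 ≤ ((x - p) / k).re →
      ‖k‖ * (159 / 160 * a * (((x - p) / k).re - 1)) ≤ u x) : False := by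
  classical
  have hk0 : 0 < ‖k‖ := norm_pos_iff.2 hk
  set ζ : ℂ → ℂ := fun x => (x - p) / k with hζ
  have hζc : Continuous ζ := by simp only [hζ, div_eq_mul_inv]; fun_prop
  have hζsub : ∀ x y, ζ x - ζ y = (x - y) / k := fun x y => by simp only [hζ]; ring
  have hζnorm : ∀ x, ‖x - p‖ = ‖ζ x‖ * ‖k‖ := fun x => by
    simp only [hζ, norm_div]; field_simp
  set P : ℂ → ℝ := fun x => ‖k‖ * liftedPlane a (ζ x) with hP
  -- The outer circle passes through the pole, which the hole |ζ| < 1/2 removes. The lift acts as a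
  -- drop on the outer circle, and P is negative on the inner one.
  set K : Set ℂ := {x | ‖ζ x - 4‖ ≤ 4 ∧ 1 / 2 ≤ ‖ζ x‖} with hK
  have hn1 : Continuous fun x => ‖ζ x - 4‖ := by fun_prop
  have hn2 : Continuous fun x => ‖ζ x‖ := by fun_prop
  have hKcl : IsClosed K := (isClosed_le hn1 continuous_const).inter (isClosed_le continuous_const hn2)
  have hKint : {x | ‖ζ x - 4‖ < 4 ∧ 1 / 2 < ‖ζ x‖} ⊆ interior K := by
    refine interior_maximal (fun x hx => ⟨hx.1.le, hx.2.le⟩) ?_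
    exact (isOpen_lt hn1 continuous_const).inter (isOpen_lt continuous_const hn2)
  have hK8 : ∀ x ∈ K, ‖ζ x‖ ≤ 8 := fun x hx => by
    have := norm_add_le (ζ x - 4) 4
    rw [sub_add_cancel] at this
    have h4 : ‖(4 : ℂ)‖ = 4 := by simp
    linarith [hx.1]
  have hKsub : K ⊆ Metric.closedBall p (20 * ‖k‖) := fun x hx => by
    rw [Metric.mem_closedBall, dist_eq_norm, hζnorm]
    have := hK8 x hx
    gcongr
    linarith
  have hKD : ∀ x ∈ K, x ∉ closure D := fun x hx => hD.notMem_of_mem_left (hKsub hx)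
  have hζ0 : ∀ x ∈ K, ζ x ≠ 0 := fun x hx h => by
    have := hx.2
    rw [h, norm_zero] at this
    linarith
  have hPh : ∀ x ∈ K, InnerProductSpace.HarmonicAt P x := fun x hx =>
    harmonicAt_liftedPlane a (hζ0 x hx)
  have hPc : ∀ x ∈ K, ContinuousAt P x := fun x hx => (hPh x hx).1.continuousAt
  have hunn : ∀ x ∉ closure D, 0 ≤ u x := fun x hx => hs.nonneg x fun h => hx (subset_closure h)
  -- on the boundary of `K`, the lifted plane is negative or below `u`
  have hPfr : ∀ x ∈ frontier K, P x < 0 ∨ (P x ≤ u x ∧ 0 < u x) := by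
    intro x hx
    have hxK : x ∈ K := hKcl.frontier_subset hx
    have hcase : ‖ζ x - 4‖ = 4 ∨ ‖ζ x‖ = 1 / 2 := by
      by_contra! h
      exact hx.2 (hKint ⟨lt_of_le_of_ne hxK.1 h.1, lt_of_le_of_ne hxK.2 h.2.symm⟩)
    rcases hcase with h | h
    · have hPx : P x = ‖k‖ * (159 / 160 * a * ((ζ x).re - 1) - a / 64) := by
        simp only [hP]; rw [liftedPlane_of_norm_sub_four_eq h hxK.2]
      rcases le_or_gt (1001 / 1000) (ζ x).re with hT | hT
      · right
        have := hlow x ((hK8 x hxK).trans (by norm_num)) hT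
        have h1 : 0 < ‖k‖ * (159 / 160 * a * ((ζ x).re - 1)) :=
          mul_pos hk0 (mul_pos (by positivity) (by linarith))
        refine ⟨le_trans ?_ this, h1.trans_le this⟩
        rw [hPx]
        gcongr
        linarith
      · left
        rw [hPx]
        exact mul_neg_of_pos_of_neg hk0 (by nlinarith)
    · left
      exact mul_neg_of_pos_of_neg hk0 (liftedPlane_neg_of_norm_eq_half ha h)
  have hPfr' : ∀ x ∈ frontier K, P x ≤ u x := fun x hx => by
    rcases hPfr x hx with h | h
    · exact h.le.trans (hunn x (hKD x (hKcl.frontier_subset hx)))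
    · exact h.1
  -- the subharmonic function filling `E`
  set q : ℂ := p + (19 / 20 : ℝ) * k with hq
  have hζq : ∀ x, ζ x - (19 / 20 : ℝ) = (x - q) / k := fun x => by
    simp only [hζ, hq]; field_simp; ring
  have hqball : Metric.ball q (1 / 25 * ‖k‖) ⊆ E := by
    intro x hx
    rw [Metric.mem_ball, dist_eq_norm] at hx
    have h1 : ‖ζ x - (19 / 20 : ℝ)‖ < 1 / 25 := by rwa [hζq, norm_div, div_lt_iff₀ hk0]
    have h2 := (abs_lt.1 ((Complex.abs_re_le_norm _).trans_lt h1)).2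
    rw [Complex.sub_re, Complex.ofReal_re] at h2
    refine hkE x ?_ (by change (ζ x).re ≤ _; linarith)
    have := norm_add_le (ζ x - (19 / 20 : ℝ)) ((19 / 20 : ℝ) : ℂ)
    rw [sub_add_cancel, Complex.norm_real, Real.norm_of_nonneg (by norm_num)] at this
    change ‖ζ x‖ ≤ 20
    linarith
  obtain ⟨ψ, hψ, hψpos⟩ := exists_isPartialBump_forall_pos hE hEc (σ := 1 / 50 * ‖k‖)
    (by positivity) (by nlinarith) hqball
  -- This is the lower bound for P on the exceptional disk of ψ, so mψ ≤ m ≤ P there and the maximum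
  -- is the harmonic P.
  set m := ‖k‖ * (a / 50) with hm
  have hm0 : 0 < m := by positivity
  set U : ℂ → ℝ := fun x => u x + m * ψ x with hU
  have hUc : ContinuousOn U Dᶜ :=
    hs.continuousOn.add (continuous_const.mul hψ.continuous).continuousOn
  have huU : ∀ x, u x ≤ U x := fun x => by
    have := mul_nonneg hm0.le (hψ.nonneg x)
    simp only [hU]; linarith
  have hUout : ∀ x ∉ E, U x = u x := fun x hx => by simp [hU, hψ.eq_zero x hx]
  have hUin : ∀ x ∈ E, U x = m * ψ x := fun x hx => by simp [hU, hEu x hx]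
  set w : ℂ → ℝ := fun x => if x ∈ K then max (U x) (P x) else U x with hw
  have hwc : ContinuousOn w Dᶜ := continuousOn_ite_max hUc hKcl
    (fun x hx => (hPc x hx).continuousWithinAt) fun x hx => (hPfr' x hx).trans (huU x)
  have hwin : ∀ x ∈ K, w x = max (U x) (P x) := fun x hx => if_pos hx
  have hwout : ∀ x ∉ K, w x = U x := fun x hx => if_neg hx
  have hUw : ∀ x, U x ≤ w x := fun x => by
    by_cases hx : x ∈ K
    · rw [hwin x hx]; exact le_max_left _ _
    · rw [hwout x hx]
  have huw : ∀ x, u x ≤ w x := fun x => (huU x).trans (hUw x)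
  have hPw : ∀ x ∈ K, P x ≤ w x := fun x hx => by rw [hwin x hx]; exact le_max_right _ _
  -- the two ways in which `w` can exceed `u`
  have hcases : ∀ x, u x < w x → (x ∈ interior K ∧ w x = P x) ∨
      (x ∈ E ∧ w x = U x ∧ (x ∈ K → P x < U x)) := by
    intro x hx
    by_cases h : x ∈ K ∧ U x ≤ P x
    · left
      have hwP : w x = P x := by rw [hwin x h.1, max_eq_right h.2]
      refine ⟨?_, hwP⟩
      by_contra hni
      have : x ∈ frontier K := ⟨subset_closure h.1, hni⟩
      have := hPfr' x this
      linarith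
    · right
      have hwU : w x = U x := by
        by_cases hxK : x ∈ K
        · rw [hwin x hxK, max_eq_left (not_le.1 fun h' => h ⟨hxK, h'⟩).le]
        · exact hwout x hxK
      refine ⟨?_, hwU, fun hxK => not_le.1 fun h' => h ⟨hxK, h'⟩⟩
      by_contra hxE
      rw [hwU, hUout x hxE] at hx
      exact lt_irrefl _ hx
  have hconc := hmax w (K ∪ closure E)
    (((isCompact_closedBall _ _).of_isClosed_subset hKcl hKsub).union hEb.isCompact_closure)
    (disjoint_union_left.2 ⟨hD.mono_left hKsub, hED⟩) ?_ hwc huw ?_ ?_ ?_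
  -- Maximality would give mψ ≤ w ≤ u = 0 on E, contradicting the positivity of ψ.
  · obtain ⟨x, hx⟩ : E.Nonempty :=
      ⟨q, hqball (Metric.mem_ball_self (by positivity))⟩
    have h1 := (hUw x).trans (hconc x)
    rw [hUin x hx, hEu x hx] at h1
    exact absurd (mul_pos hm0 (hψpos x hx)) (not_lt.2 h1)
  · intro x hx
    rw [mem_union, not_or] at hx
    rw [hwout x hx.1, hUout x fun h => hx.2 (subset_closure h)]
  · intro x hx
    rcases hcases x hx with h | h
    · exact hG (hKsub (interior_subset h.1))
    · exact hEG h.1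
  · intro x hx
    rcases hcases x hx with ⟨hxK, hwP⟩ | ⟨hxE, hwU, hPU⟩
    · refine (viscLaplacianNonneg_of_harmonicAt (hPh x (interior_subset hxK))).of_touching hwP.symm ?_
      filter_upwards [isOpen_interior.mem_nhds hxK] with y hy using hPw y (interior_subset hy)
    · have hxq : 1 / 50 * ‖k‖ < ‖x - q‖ := by
        by_contra! hle
        have h1 : ‖ζ x - (19 / 20 : ℝ)‖ ≤ 1 / 50 := by rwa [hζq, norm_div, div_le_iff₀ hk0]
        have h2 := liftedPlane_lower ha h1
        have h3 : m ≤ P x := by simp only [hm, hP]; gcongr; exact h2.1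
        have h4 := hPU ⟨h2.2.1.le, h2.2.2.1.le⟩
        rw [hUin x hxE] at h4
        have := hψ.le_one x
        nlinarith
      refine ((hψ.visc x (hψpos x hxE) hxq).const_mul hm0).of_touching ?_ ?_
      · rw [hwU, hUin x hxE]
      · filter_upwards [hE.mem_nhds hxE] with y hy
        rw [← hUin y hy]; exact hUw y
  · intro x hx hxD hxu ν α hν hB
    have hwat : ContinuousAt w x := hwc.continuousAt (mem_of_superset
      (isClosed_closure.isOpen_compl.mem_nhds hxD) (compl_subset_compl.2 subset_closure))
    have hxD' : x ∉ D := fun h => hxD (subset_closure h)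
    have hw0 : w x ≤ 0 := not_lt.1 fun h => notMem_frontier_posSet hxD hwat h hx
    have hu0 : u x = 0 := le_antisymm ((huw x).trans hw0) (hunn x hxD)
    have hxE : x ∉ E := fun h => by
      have := (hUw x).trans hw0
      rw [hUin x h] at this
      exact absurd (mul_pos hm0 (hψpos x h)) (not_lt.2 this)
    -- The hypothesis on ∂E enters here: a new free boundary point can lie neither in E, where w >
    -- 0, nor on ∂E, which is in the closure of Ω(u). Near it only P can make w differ from u.
    have hxE' : x ∉ closure E := fun h => hxu (hEfr ⟨h, fun h' => hxE (interior_subset h')⟩)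
    have hUev : ∀ᶠ y in 𝓝 x, U y = u y := by
      filter_upwards [isClosed_closure.isOpen_compl.mem_nhds hxE'] with y hy
      exact hUout y fun h => hy (subset_closure h)
    have hxK : x ∈ K := by
      by_contra h
      refine hxu (mem_closure_posSet_congr (w := w) ?_ hx.1)
      filter_upwards [hUev, hKcl.isOpen_compl.mem_nhds h] with y h1 h2
      rw [hwout y h2, h1]
    have hPx : 0 ≤ P x := by
      by_contra! h
      refine hxu (mem_closure_posSet_congr (w := w) ?_ hx.1)
      filter_upwards [hUev, (hPc x hxK).eventually_lt_const h,
        isClosed_closure.isOpen_compl.mem_nhds hxD] with y h1 h2 h3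
      by_cases hy : y ∈ K
      · rw [hwin y hy, h1, max_eq_left (h2.le.trans (hunn y h3))]
      · rw [hwout y hy, h1]
    have hPx0 : P x = 0 := le_antisymm ((hPw x hxK).trans hw0) hPx
    have hxint : x ∈ interior K := by
      by_contra h
      rcases hPfr x ⟨subset_closure hxK, h⟩ with h | h
      · linarith
      · linarith [h.2]
    -- Zeros of P further left lie in E, and those further right are excluded by u > 0; only the
    -- thin strip around T = 1 needs the slope estimate.
    have hT1 : 999 / 1000 ≤ (ζ x).re := by
      by_contra! h
      exact hxE (hkE x ((hK8 x hxK).trans (by norm_num)) h.le)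
    have hT2 : (ζ x).re ≤ 1001 / 1000 := by
      by_contra! h
      have h1 := hlow x ((hK8 x hxK).trans (by norm_num)) h.le
      have h2 : 0 < ‖k‖ * (159 / 160 * a * ((ζ x).re - 1)) :=
        mul_pos hk0 (mul_pos (by positivity) (by linarith))
      change ‖k‖ * (159 / 160 * a * ((ζ x).re - 1)) ≤ u x at h1
      linarith
    have hslope := liftedPlane_slope ha ((mul_eq_zero.1 hPx0).resolve_left hk0.ne') hT1 hT2
    obtain ⟨L, hL, hLe⟩ := hasFDerivAt_liftedPlane a hk (hζ0 x hxK)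
    rw [← hLe] at hslope
    refine (hf x (hKsub hxK)).trans (hslope.trans ?_)
    refine le_of_belowPlane hν ?_ hB hL hPx0 ?_ (lt_of_lt_of_le (by positivity) hslope)
    · rw [norm_div, Complex.norm_real, norm_norm, div_self hk0.ne']
    · filter_upwards [isOpen_interior.mem_nhds hxint] with y hy using hPw y (interior_subset hy)

/-! ### Growth of `u` next to a disk on which it vanishes -/

lemma norm_add_smul_sub_le {ν : ℂ} (hν : ‖ν‖ = 1) {s : ℝ} (hs : 0 < s) (h : ℂ) :
    ‖h + s • ν‖ - s ≤ ⟪h, ν⟫_ℝ + ‖h‖ ^ 2 / (2 * s) := by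
  have h1 : ‖h + s • ν‖ ^ 2 = ‖h‖ ^ 2 + 2 * (s * ⟪h, ν⟫_ℝ) + s ^ 2 := by
    rw [norm_add_sq_real, inner_smul_right, norm_smul, hν]
    simp
  have h2 : ⟪h, ν⟫_ℝ + ‖h‖ ^ 2 / (2 * s) = (‖h + s • ν‖ ^ 2 - s ^ 2) / (2 * s) := by
    rw [h1]; field_simp; ring
  rw [h2, le_div_iff₀ (by positivity)]
  nlinarith [sq_nonneg (‖h + s • ν‖ - s)]

/-- Comparison on the annulus with the logarithmic function vanishing on the inner circle and equal
to max u on the outer one, followed by log t ≤ t - 1. -/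
lemma IsSubsolution.exists_linear_bound {D : Set ℂ} {g f u : ℂ → ℝ} (hs : IsSubsolution D g f u)
    {y : ℂ} {s : ℝ} (hs0 : 0 < s) (hD : Disjoint (Metric.closedBall y (2 * s)) (closure D))
    (hu : ∀ x ∈ Metric.closedBall y s, u x = 0) :
    ∃ C, 0 ≤ C ∧ ∀ x ∈ Metric.closedBall y (2 * s), u x ≤ C * max (‖x - y‖ - s) 0 := by
  have hcl : ∀ x ∈ Metric.closedBall y (2 * s), x ∉ closure D := fun x hx =>
    hD.notMem_of_mem_left hx
  have hDc : ∀ x ∈ Metric.closedBall y (2 * s), x ∉ D := fun x hx h =>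
    hcl x hx (subset_closure h)
  have huc : ContinuousOn u (Metric.closedBall y (2 * s)) := hs.continuousOn.mono hDc
  obtain ⟨xm, hxm, hmax⟩ := (isCompact_closedBall y (2 * s)).exists_isMaxOn
    ⟨y, Metric.mem_closedBall_self (by positivity)⟩ huc
  set B := u xm with hB
  have hB0 : 0 ≤ B := hs.nonneg xm (hDc xm hxm)
  have hl2 : 0 < Real.log 2 := Real.log_pos one_lt_two
  set K := Metric.closedBall y (2 * s) \ Metric.ball y s with hK
  set H : ℂ → ℝ := fun x => B / Real.log 2 * Real.log ‖x - y‖ + -(B / Real.log 2 * Real.log s)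
    with hH
  have hKs : ∀ x ∈ K, s ≤ ‖x - y‖ ∧ ‖x - y‖ ≤ 2 * s := fun x hx => by
    have h1 := hx.1
    have h2 := hx.2
    rw [Metric.mem_closedBall, dist_eq_norm] at h1
    rw [Metric.mem_ball, dist_eq_norm, not_lt] at h2
    exact ⟨h2, h1⟩
  have hHh : ∀ x ∈ K, InnerProductSpace.HarmonicAt H x := fun x hx =>
    harmonicAt_log_norm_sub (by
      rintro rfl
      have := (hKs x hx).1
      simp at this
      linarith) _ _
  have hHeq : ∀ x ∈ K, H x = B / Real.log 2 * Real.log (‖x - y‖ / s) := fun x hx => by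
    rw [Real.log_div (hs0.trans_le (hKs x hx).1).ne' hs0.ne']
    simp only [hH]; ring
  have hHnn : ∀ x ∈ K, 0 ≤ H x := fun x hx => by
    rw [hHeq x hx]
    exact mul_nonneg (by positivity) (Real.log_nonneg ((one_le_div hs0).2 (hKs x hx).1))
  have hcomp : ∀ x ∈ K, u x ≤ H x := by
    refine comparison ((isCompact_closedBall _ _).diff Metric.isOpen_ball)
      (huc.mono sdiff_subset) (fun x hx => (hHh x hx).1.continuousAt.continuousWithinAt)
      fun x hx hlt => ?_
    have hpos : 0 < u x := (hHnn x hx).trans_lt hlt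
    have h1 : s < ‖x - y‖ := by
      by_contra! h
      rw [hu x (by rwa [Metric.mem_closedBall, dist_eq_norm])] at hpos
      exact lt_irrefl _ hpos
    have h2 : ‖x - y‖ < 2 * s := by
      refine lt_of_le_of_ne (hKs x hx).2 fun h => ?_
      rw [hHeq x hx, h, mul_div_cancel_right₀ _ hs0.ne', div_mul_cancel₀ _ hl2.ne'] at hlt
      exact absurd (hmax hx.1) (not_le.2 hlt)
    refine ⟨?_, hs.subharmonic x ⟨hDc x hx.1, hpos⟩ (hcl x hx.1), (hHh x hx).1,
      (hHh x hx).2.self_of_nhds.le⟩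
    have hcn : ContinuousAt (fun x : ℂ => ‖x - y‖) x := by fun_prop
    filter_upwards [hcn.eventually_const_lt h1, hcn.eventually_lt_const h2] with z hz1 hz2
    refine ⟨?_, ?_⟩
    · rw [Metric.mem_closedBall, dist_eq_norm]; exact hz2.le
    · rw [Metric.mem_ball, dist_eq_norm, not_lt]; exact hz1.le
  refine ⟨B / Real.log 2 / s, by positivity, fun x hx => ?_⟩
  by_cases hxs : x ∈ Metric.ball y s
  · rw [hu x (Metric.ball_subset_closedBall hxs)]
    positivity
  · have hxK : x ∈ K := ⟨hx, hxs⟩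
    have h1 := (hKs x hxK).1
    rw [max_eq_left (sub_nonneg.2 h1)]
    refine (hcomp x hxK).trans ?_
    rw [hHeq x hxK]
    have h2 := Real.log_le_sub_one_of_pos (div_pos (hs0.trans_le h1) hs0)
    have h3 : B / Real.log 2 / s * (‖x - y‖ - s) = B / Real.log 2 * (‖x - y‖ / s - 1) := by
      field_simp
    rw [h3]
    gcongr

/-- The distance to the disk exceeds its linearization at `z` by at most |x - z|²/(2s), which is
absorbed in the o-term. -/
lemma belowPlane_of_eventually_le {u : ℂ → ℝ} {y z : ℂ} {s A : ℝ} (hs : 0 < s) (hA : 0 ≤ A)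
    (hz : ‖z - y‖ = s) (h : ∀ᶠ x in 𝓝 z, u x ≤ A * max (‖x - y‖ - s) 0) :
    BelowPlane u z ((s : ℂ)⁻¹ * (z - y)) A := by
  have hs' : (s : ℂ) ≠ 0 := by exact_mod_cast hs.ne'
  set ν := (s : ℂ)⁻¹ * (z - y) with hν
  have hν1 : ‖ν‖ = 1 := by simp [hν, hz, abs_of_pos hs, hs.ne']
  refine ⟨fun x => A / (2 * s) * ‖x - z‖ ^ 2, ?_, ?_⟩
  · refine IsLittleO.const_mul_left ?_ _
    have : Tendsto (fun x : ℂ => x - z) (𝓝 z) (𝓝 0) := by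
      have : ContinuousAt (fun x : ℂ => x - z) z := by fun_prop
      simpa [ContinuousAt] using this
    exact (isLittleO_norm_pow_id (E' := ℂ) one_lt_two).comp_tendsto this
  · filter_upwards [h] with x hx
    refine hx.trans ?_
    have h1 := norm_add_smul_sub_le hν1 hs (x - z)
    have h2 : x - z + s • ν = x - y := by
      rw [Complex.real_smul, hν, mul_inv_cancel_left₀ hs']; ring
    rw [h2] at h1
    have h3 : max (‖x - y‖ - s) 0 ≤ max ⟪x - z, ν⟫_ℝ 0 + ‖x - z‖ ^ 2 / (2 * s) := by
      refine max_le (h1.trans ?_) (by positivity)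
      gcongr
      exact le_max_left _ _
    calc A * max (‖x - y‖ - s) 0 ≤ A * (max ⟪x - z, ν⟫_ℝ 0 + ‖x - z‖ ^ 2 / (2 * s)) := by gcongr
      _ = A * max ⟪x - z, ν⟫_ℝ 0 + A / (2 * s) * ‖x - z‖ ^ 2 := by ring

set_option maxHeartbeats 1600000 in
/-- A bounded component of the interior of the zero set, away from `D` and inside of the region
where `u` is maximal, cannot exist. -/
theorem false_of_component {D G E : Set ℂ} {g f u : ℂ → ℝ} (hs : IsSubsolution D g f u)
    (hmax : MaximalOn D f u G) (hGo : IsOpen G) (hf : Continuous f) {Lam : ℝ}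
    (hfpos : ∀ x, 0 < f x) (hfLam : ∀ x, f x ≤ Lam) (hE : IsOpen E) (hEc : IsPreconnected E)
    (hEb : Bornology.IsBounded E) (hED : Disjoint (closure E) (closure D)) (hEG : E ⊆ G)
    (hEu : ∀ x ∈ E, u x = 0) (hEfr : frontier E ⊆ closure (posSet D u))
    (hne : (frontier E ∩ G).Nonempty) : False := by
  have hLam : 0 < Lam := (hfpos 0).trans_le (hfLam 0)
  -- a boundary point `z` of `E` touched by a disk inside of `E`
  obtain ⟨z', hz'fr, hz'G⟩ := hne
  have hz'D : z' ∉ closure D := hED.notMem_of_mem_left hz'fr.1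
  obtain ⟨ε, hε, hεb⟩ := Metric.isOpen_iff.1 (hGo.inter isClosed_closure.isOpen_compl) z'
    ⟨hz'G, hz'D⟩
  obtain ⟨y, hyE, hyz'⟩ := Metric.mem_closure_iff.1 hz'fr.1 (ε / 8) (by positivity)
  have hz'E : z' ∉ E := fun h => hz'fr.2 (by rwa [hE.interior_eq])
  have hEcne : (Eᶜ).Nonempty := ⟨z', hz'E⟩
  set s := Metric.infDist y Eᶜ with hsdef
  have hs0 : 0 < s := (hE.isClosed_compl.notMem_iff_infDist_pos hEcne).1 (by simpa using hyE)
  have hsε : s < ε / 8 := (Metric.infDist_le_dist_of_mem hz'E).trans_lt (by rwa [dist_comm])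
  obtain ⟨z, hzE, hzs⟩ := hE.isClosed_compl.exists_infDist_eq_dist hEcne y
  rw [← hsdef] at hzs
  have hzn : ‖z - y‖ = s := by rw [← dist_eq_norm, dist_comm, ← hzs]
  have hbE : Metric.ball y s ⊆ E := by
    intro x hx
    by_contra h
    have := Metric.infDist_le_dist_of_mem (x := y) (show x ∈ Eᶜ from h)
    rw [Metric.mem_ball, dist_comm] at hx
    linarith
  have hcb : Metric.closedBall y s ⊆ closure E := by
    rw [← closure_ball y hs0.ne']
    exact closure_mono hbE
  have hzfr : z ∈ frontier E := by
    refine ⟨hcb (by rw [Metric.mem_closedBall, dist_eq_norm, hzn]), fun h => hzE (interior_subset h)⟩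
  have hzD : z ∉ closure D := hED.notMem_of_mem_left hzfr.1
  have hbig : ∀ x, ‖x - z‖ ≤ ε / 2 → x ∈ G ∧ x ∉ closure D := by
    intro x hx
    refine hεb ?_
    rw [Metric.mem_ball, dist_eq_norm]
    have h1 : ‖y - z'‖ < ε / 8 := by rwa [← dist_eq_norm, dist_comm]
    have h2 := norm_add₃_le (a := x - z) (b := z - y) (c := y - z')
    have h3 : x - z + (z - y) + (y - z') = x - z' := by ring
    rw [h3] at h2
    linarith
  have hD2 : Disjoint (Metric.closedBall y (2 * s)) (closure D) := by
    rw [Set.disjoint_left]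
    intro x hx
    refine (hbig x ?_).2
    rw [Metric.mem_closedBall, dist_eq_norm] at hx
    have h2 := norm_add_le (x - y) (y - z)
    rw [sub_add_sub_cancel, norm_sub_rev y z] at h2
    linarith
  have hu0 : ∀ x ∈ Metric.closedBall y s, u x = 0 := by
    intro x hx
    have hxD : x ∉ closure D :=
      hD2.notMem_of_mem_left (Metric.closedBall_subset_closedBall (by linarith) hx)
    have hmem : u x ∈ closure (u '' E) :=
      (hs.continuousAt hxD).continuousWithinAt.mem_closure_image (hcb hx)
    have hsub : u '' E ⊆ {0} := by
      rintro _ ⟨e, he, rfl⟩; exact hEu e he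
    simpa using closure_mono hsub hmem
  obtain ⟨C, hC0, hC⟩ := hs.exists_linear_bound hs0 hD2 hu0
  have hzu : z ∈ frontier (posSet D u) := by
    refine ⟨hEfr hzfr, fun h => ?_⟩
    have := (interior_subset h).2
    rw [hu0 z (by rw [Metric.mem_closedBall, dist_eq_norm, hzn])] at this
    exact lt_irrefl _ this
  have hT : TangentBallOutside (posSet D u) z y s := by
    refine ⟨hs0, by rw [dist_eq_norm, hzn], ?_⟩
    rw [Set.disjoint_left]
    intro x hx hxu
    have := hxu.2
    rw [hEu x (hbE hx)] at this
    exact lt_irrefl _ this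
  -- the optimal slope at `z`
  set S : Set ℝ := {A | 0 ≤ A ∧ ∀ᶠ x in 𝓝 z, u x ≤ A * max (‖x - y‖ - s) 0} with hS
  have hCS : C ∈ S := by
    refine ⟨hC0, ?_⟩
    have : z ∈ Metric.ball y (2 * s) := by
      rw [Metric.mem_ball, dist_eq_norm, hzn]; linarith
    filter_upwards [Metric.isOpen_ball.mem_nhds this] with x hx
    exact hC x (Metric.ball_subset_closedBall hx)
  have hSf : ∀ A ∈ S, √(f z) ≤ A := fun A hA =>
    hs.freeBoundary z hzu hzD y s hT A (belowPlane_of_eventually_le hs0 hA.1 hzn hA.2)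
  have hSbdd : BddBelow S := ⟨_, hSf⟩
  set a := sInf S with ha
  have hfa : √(f z) ≤ a := le_csInf ⟨C, hCS⟩ hSf
  have ha0 : 0 < a := (Real.sqrt_pos.2 (hfpos z)).trans_le hfa
  obtain ⟨δ₀, hδ₀, hflat⟩ := flat_lower_bound (τ := 1 / 1000) (κ := a / 160) ha0 hLam
    (by norm_num) (by norm_num) (by positivity)
  -- Below δ₀ for the flatness lemma, below 1/2000 for the strip of width 1/1000 around T = 1, and
  -- below a/2 so that a - δ ≥ 0 competes in `S`.
  set δ := min δ₀ (min (1 / 2000) (a / 2)) with hδdef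
  have hδ0 : 0 < δ := by positivity
  have hδ1 : δ ≤ 1 / 2000 := (min_le_right _ _).trans (min_le_left _ _)
  have hδa : δ ≤ a / 2 := (min_le_right _ _).trans (min_le_right _ _)
  have hevup : ∀ᶠ x in 𝓝 z, u x ≤ (a + δ) * max (‖x - y‖ - s) 0 := by
    obtain ⟨A, hA, hAlt⟩ := exists_lt_of_csInf_lt ⟨C, hCS⟩ (show sInf S < a + δ by linarith)
    refine hA.2.mono fun x hx => hx.trans ?_
    gcongr
  have hevf : ∀ᶠ x in 𝓝 z, √(f x) < 161 / 160 * a := by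
    have hcf : ContinuousAt (fun x => √(f x)) z := by fun_prop
    exact hcf.eventually_lt_const (by linarith)
  obtain ⟨ϱ₀, hϱ₀, hϱb⟩ := Metric.nhds_basis_ball.mem_iff.1 (hevup.and hevf)
  -- Points of the frame satisfy |x - z| ≤ 20ℓ + 2ℓ + ϱ < 24ϱ. Since 441 = 21² and |h| ≤ 21ℓ, the
  -- second bound makes the curvature error |h|²/(2s) at most ℓδ.
  set ϱ := min (min ϱ₀ (ε / 2) / 24) (2 * s * δ / 441) with hϱdef
  have hϱ : 0 < ϱ := by positivity
  have hϱ24 : 24 * ϱ ≤ min ϱ₀ (ε / 2) := by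
    have : ϱ ≤ min ϱ₀ (ε / 2) / 24 := min_le_left _ _
    linarith
  have hϱ₀' : 24 * ϱ ≤ ϱ₀ := hϱ24.trans (min_le_left _ _)
  have hϱε : 24 * ϱ ≤ ε / 2 := hϱ24.trans (min_le_right _ _)
  have hϱs : 441 * ϱ ≤ 2 * s * δ := by
    have : ϱ ≤ 2 * s * δ / 441 := min_le_right _ _
    linarith
  -- Otherwise a - δ would belong to `S`, below its infimum.
  have hfreq : ∃ᶠ x in 𝓝 z, (a - δ) * max (‖x - y‖ - s) 0 < u x := by
    intro h
    have hmem : a - δ ∈ S := ⟨by linarith, h.mono fun x hx => not_lt.1 hx⟩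
    have := csInf_le hSbdd hmem
    linarith
  obtain ⟨xk, hxk, hxkϱ⟩ := (hfreq.and_eventually (Metric.ball_mem_nhds z hϱ)).exists
  rw [dist_eq_norm] at hxkϱ
  set ℓ := ‖xk - y‖ - s with hℓ
  have hℓ0 : 0 < ℓ := by
    by_contra! h
    have h1 : u xk = 0 := hu0 xk (by rw [Metric.mem_closedBall, dist_eq_norm]; linarith)
    rw [max_eq_right h, mul_zero, h1] at hxk
    exact lt_irrefl _ hxk
  rw [max_eq_left hℓ0.le] at hxk
  have hℓϱ : ℓ < ϱ := by
    have h2 := norm_add_le (xk - z) (z - y)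
    rw [sub_add_sub_cancel, hzn] at h2
    linarith
  have hny : 0 < ‖xk - y‖ := by linarith
  have hnyc : (‖xk - y‖ : ℂ) ≠ 0 := by exact_mod_cast hny.ne'
  set ν : ℂ := (xk - y) / ‖xk - y‖ with hν
  have hν1 : ‖ν‖ = 1 := by simp [hν, hny.ne']
  have hνy : xk = y + ‖xk - y‖ * ν := by rw [hν]; field_simp; ring
  -- In the frame ζ = (x - p)/k the tangent line to the disk at y + sν is T = 1, the contact point
  -- `xk` is ζ = 2, and the pole ζ = 0 lies at depth ℓ inside the disk.
  set k : ℂ := ℓ * ν with hk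
  have hkn : ‖k‖ = ℓ := by simp [hk, hν1, abs_of_pos hℓ0]
  have hk0 : k ≠ 0 := norm_pos_iff.1 (by rw [hkn]; exact hℓ0)
  set p : ℂ := xk - 2 * k with hp
  have hball : ∀ x ∈ Metric.closedBall p (20 * ‖k‖), ‖x - z‖ < 24 * ϱ := by
    intro x hx
    rw [Metric.mem_closedBall, dist_eq_norm, hkn] at hx
    have h2 := norm_add₃_le (a := x - p) (b := p - xk) (c := xk - z)
    have h3 : x - p + (p - xk) + (xk - z) = x - z := by ring
    have h4 : ‖p - xk‖ = 2 * ℓ := by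
      rw [hp, sub_sub_cancel_left, norm_neg, norm_mul, hkn]; simp
    rw [h3, h4] at h2
    linarith
  have hζp : ∀ x, ‖(x - p) / k‖ ≤ 20 → x ∈ Metric.closedBall p (20 * ‖k‖) := fun x hx => by
    rw [norm_div, div_le_iff₀ (norm_pos_iff.2 hk0)] at hx
    rwa [Metric.mem_closedBall, dist_eq_norm]
  -- geometry of the frame
  have hgeo : ∀ x, ∃ h : ℂ, x - y = h + s • ν ∧ ⟪h, ν⟫_ℝ = ℓ * (((x - p) / k).re - 1) ∧
      (‖(x - p) / k‖ ≤ 20 → ‖h‖ ^ 2 ≤ 441 * ℓ ^ 2) := by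
    intro x
    refine ⟨((x - p) / k - 1) * k, ?_, ?_, ?_⟩
    · have h1 : ((x - p) / k - 1) * k = x - p - k := by field_simp
      have h2 : (‖xk - y‖ : ℂ) = s + ℓ := by rw [hℓ]; push_cast; ring
      rw [h1, hp, Complex.real_smul]
      have h3 : xk = y + (s + ℓ) * ν := by rw [← h2]; exact hνy
      have h4 : x - y = x - xk + ((s : ℂ) + ℓ) * ν := by
        have : xk - y = (s + ℓ) * ν := by rw [← h2]; linear_combination hνy
        linear_combination this
      rw [h4, hk]; ring
    · rw [inner_eq_frame, hk]
      have h1 : ν * (starRingEnd ℂ) ν = 1 := by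
        rw [Complex.mul_conj, Complex.normSq_eq_norm_sq, hν1]; simp
      have h2 : ((x - p) / (↑ℓ * ν) - 1) * (↑ℓ * ν) * (starRingEnd ℂ) ν =
          ℓ * ((x - p) / (↑ℓ * ν) - 1) := by
        linear_combination (((x - p) / (↑ℓ * ν) - 1) * ℓ) * h1
      rw [h2, Complex.re_ofReal_mul, Complex.sub_re, Complex.one_re]
    · intro hx
      have h1 : ‖(x - p) / k - 1‖ ≤ 21 := by
        refine (norm_sub_le _ _).trans ?_
        rw [norm_one]; linarith
      rw [norm_mul, hkn, mul_pow]
      have : ‖(x - p) / k - 1‖ ^ 2 ≤ 21 ^ 2 := by gcongr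
      nlinarith [sq_nonneg ℓ]
  have hG20 : Metric.closedBall p (20 * ‖k‖) ⊆ G := fun x hx =>
    (hbig x ((hball x hx).le.trans hϱε)).1
  have hD20 : Disjoint (Metric.closedBall p (20 * ‖k‖)) (closure D) := by
    rw [Set.disjoint_left]
    exact fun x hx => (hbig x ((hball x hx).le.trans hϱε)).2
  have hϱx : ∀ x ∈ Metric.closedBall p (20 * ‖k‖), u x ≤ (a + δ) * max (‖x - y‖ - s) 0 ∧
      √(f x) < 161 / 160 * a := fun x hx => hϱb (by
    rw [Metric.mem_ball, dist_eq_norm]; exact (hball x hx).trans_le hϱ₀')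
  have hlow := hflat δ hδ0 (min_le_left _ _) hs hmax hfLam p k hk0 hG20 hD20 (by
    intro x hx hxT
    refine (hϱx x (hζp x hx)).1.trans ?_
    obtain ⟨h, h1, h2, h3⟩ := hgeo x
    have h4 := norm_add_smul_sub_le hν1 hs0 h
    rw [← h1, h2] at h4
    have h5 : ‖h‖ ^ 2 / (2 * s) ≤ ℓ * δ := by
      rw [div_le_iff₀ (by positivity)]
      refine (h3 hx).trans ?_
      nlinarith
    rw [hkn]
    have h6 : max (‖x - y‖ - s) 0 ≤ ℓ * (((x - p) / k).re - 1 + δ) := by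
      refine max_le (by linarith) (mul_nonneg hℓ0.le (by linarith))
    calc (a + δ) * max (‖x - y‖ - s) 0 ≤ (a + δ) * (ℓ * (((x - p) / k).re - 1 + δ)) := by gcongr
      _ = ℓ * ((a + δ) * (((x - p) / k).re - 1 + δ)) := by ring) (by
    have : p + 2 * k = xk := by rw [hp]; ring
    rw [this, hkn]
    linarith)
  refine false_of_flat_component hs hmax hE hEc hEb hED hEG hEu hEfr ha0 hk0 hG20 hD20 ?_
    (fun x hx => (hϱx x hx).2.le) ?_
  · intro x hx hxT
    refine hbE ?_
    rw [Metric.mem_ball, dist_eq_norm]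
    obtain ⟨h, h1, h2, h3⟩ := hgeo x
    have h4 : ‖x - y‖ ^ 2 < s ^ 2 := by
      rw [h1, norm_add_sq_real, inner_smul_right, norm_smul, hν1, h2]
      simp only [Real.norm_eq_abs, mul_one, sq_abs]
      have h5 := h3 hx
      -- Depth ℓ/1000 behind the tangent line outweighs the curvature of the circle at this scale,
      -- so such points are inside the disk.
      have h6 : 441 * ℓ < s / 1000 := by nlinarith
      have h7 : ℓ * (((x - p) / k).re - 1) ≤ ℓ * (-(1 / 1000)) := by
        gcongr
        linarith
      have h8 : s * (ℓ * (((x - p) / k).re - 1)) ≤ s * (ℓ * (-(1 / 1000))) := by gcongr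
      nlinarith
    exact lt_of_pow_lt_pow_left₀ 2 hs0.le h4
  · intro x hx hxT
    have := hlow x hx (by linarith)
    have e : a - a / 160 = 159 / 160 * a := by ring
    rwa [e] at this

/-! ### The outer radius, the rescaling and the position of the component -/

lemma lt_outerRadius_of_barrier_pos {lam M r : ℝ} (hr : 0 < r) {x : ℂ}
    (hx : 0 < barrier lam M r x) : r < outerRadius lam M r := by
  -- The logarithm is 0 if R₀ = r, and also if R₀ = 0, the default value for an empty set. Division
  -- by it then gives 0 and the barrier vanishes.
  have hlog : Real.log (r / outerRadius lam M r) ≠ 0 := by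
    intro h
    simp [barrier, h] at hx
  rcases Set.eq_empty_or_nonempty
    {R : ℝ | r < R ∧ M ^ 2 / (R ^ 2 * Real.log (r / R) ^ 2) < lam} with h | h
  · have : outerRadius lam M r = 0 := by rw [outerRadius, h, Real.sInf_empty]
    simp [this] at hlog
  · have hle : r ≤ outerRadius lam M r := le_csInf h fun R hR => hR.1.le
    refine hle.lt_of_ne fun h' => hlog ?_
    rw [← h', div_self hr.ne', Real.log_one]

/-- The affine map `x ↦ x₀ - ρ x`. -/
def rescaling (x₀ : ℂ) {ρ : ℝ} (hρ : ρ ≠ 0) : ℂ ≃ₜ ℂ :=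
  (Homeomorph.mulLeft₀ (ρ : ℂ) (Complex.ofReal_ne_zero.2 hρ)).trans (Homeomorph.subLeft x₀)

lemma rescaling_apply (x₀ : ℂ) {ρ : ℝ} (hρ : ρ ≠ 0) (x : ℂ) :
    rescaling x₀ hρ x = x₀ - ρ * x := rfl

lemma rescaling_mem_ball {x₀ x : ℂ} {ρ : ℝ} (hρ : 0 < ρ) (hx : x ∈ Metric.ball (0 : ℂ) 1) :
    rescaling x₀ hρ.ne' x ∈ Metric.ball x₀ ρ := by
  rw [mem_ball_zero_iff] at hx
  rw [Metric.mem_ball, dist_eq_norm, rescaling_apply, sub_sub_cancel_left, norm_neg, norm_mul,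
    Complex.norm_real, Real.norm_of_nonneg hρ.le]
  nlinarith

/-- Near a boundary point off the closure of Ω(u) the function vanishes, since the point is still
interior to the unit ball. A small disk of zeros would then belong to the component, contradicting
that the point is on its boundary. -/
lemma frontier_rescaling_component {D : Set ℂ} {u : ℂ → ℝ} (hnonneg : ∀ x ∉ D, 0 ≤ u x)
    {x₀ : ℂ} {ρ : ℝ} (hρ : 0 < ρ) (hball : Metric.ball x₀ ρ ⊆ Dᶜ) {x : ℂ}
    (hcl : closure (connectedComponentIn (zeroInterior (normalized u x₀ ρ)) x) ⊆
      Metric.ball (0 : ℂ) 1) :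
    frontier (rescaling x₀ hρ.ne' '' connectedComponentIn (zeroInterior (normalized u x₀ ρ)) x) ⊆
      closure (posSet D u) := by
  set Φ := rescaling x₀ hρ.ne' with hΦ
  set Z := zeroInterior (normalized u x₀ ρ) with hZ
  have hE0 : IsOpen (connectedComponentIn Z x) := isOpen_interior.connectedComponentIn
  rw [← Φ.image_frontier]
  rintro _ ⟨x₁, hx₁, rfl⟩
  by_contra hn
  have h1 : ∀ᶠ z in 𝓝 x₁, z ∈ Metric.ball (0 : ℂ) 1 :=
    Metric.isOpen_ball.mem_nhds (hcl hx₁.1)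
  have h2 : ∀ᶠ z in 𝓝 x₁, Φ z ∈ (closure (posSet D u))ᶜ :=
    Φ.continuous.continuousAt.eventually (isClosed_closure.isOpen_compl.mem_nhds hn)
  obtain ⟨ε, hε, hb⟩ := Metric.eventually_nhds_iff_ball.1 (h1.and h2)
  have hsub : Metric.ball x₁ ε ⊆ Z := by
    refine interior_maximal (fun z hz => ⟨(hb z hz).1, ?_⟩) Metric.isOpen_ball
    have hzD : Φ z ∉ D := hball (rescaling_mem_ball hρ (hb z hz).1)
    have hle : u (Φ z) ≤ 0 := not_lt.1 fun h => (hb z hz).2 (subset_closure ⟨hzD, h⟩)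
    have h0 : u (Φ z) = 0 := le_antisymm hle (hnonneg _ hzD)
    rw [hΦ, rescaling_apply] at h0
    rw [normalized, h0, zero_div]
  obtain ⟨y, hyE, hy⟩ := Metric.mem_closure_iff.1 hx₁.1 ε hε
  have hyb : y ∈ Metric.ball x₁ ε := Metric.mem_ball'.2 hy
  have h3 : Metric.ball x₁ ε ⊆ connectedComponentIn Z x := by
    rw [connectedComponentIn_eq hyE]
    exact (convex_ball x₁ ε).isPreconnected.subset_connectedComponentIn hyb hsub
  exact hx₁.2 (hE0.interior_eq.symm ▸ h3 (Metric.mem_ball_self hε))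

/-- A bounded open set whose frontier lies in a closed ball around the origin is contained in the
corresponding open ball. -/
lemma subset_ball_of_frontier_subset {E : Set ℂ} (hE : IsOpen E) (hEb : Bornology.IsBounded E)
    {R : ℝ} (hR : 0 < R) (hfr : frontier E ⊆ Metric.closedBall 0 R) : E ⊆ Metric.ball 0 R := by
  intro y hy
  by_contra hyR
  rw [mem_ball_zero_iff, not_lt] at hyR
  have hcont : ContinuousAt (fun t : ℝ => t • y) 1 := by fun_prop
  have h1 : ∀ᶠ t : ℝ in 𝓝[>] 1, t • y ∈ E :=
    (hcont.eventually (hE.mem_nhds (by simpa using hy))).filter_mono nhdsWithin_le_nhds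
  obtain ⟨t, htE, ht⟩ := (h1.and self_mem_nhdsWithin).exists
  have ht1 : 1 < t := ht
  have hy0 : 0 < ‖y‖ := hR.trans_le hyR
  -- The ray starts at t > 1 because y may lie on the circle of radius R, where frontier points are
  -- allowed. Beyond it the ray meets no frontier point, so it stays in the bounded set E.
  set S : Set ℂ := (fun c : ℝ => c • y) '' Ici t
  have hS : IsPreconnected S := isPreconnected_Ici.image _ (by fun_prop)
  have hSR : ∀ c ∈ Ici t, R < ‖c • y‖ := by
    intro c hc
    have hc1 : 1 < c := ht1.trans_le hc
    rw [norm_smul, Real.norm_of_nonneg (by linarith)]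
    nlinarith
  have hSE : S ⊆ E := by
    refine hS.subset_of_closure_inter_subset hE ⟨_, ⟨t, self_mem_Ici, rfl⟩, htE⟩ ?_
    rintro _ ⟨hz, c, hc, rfl⟩
    by_contra hzE
    have := hfr ⟨hz, fun h => hzE (interior_subset h)⟩
    rw [mem_closedBall_zero_iff] at this
    exact (hSR c hc).not_ge this
  obtain ⟨C, hC⟩ := hEb.exists_norm_le
  have hc : t + |C| / ‖y‖ ∈ Ici t := le_add_of_nonneg_right (div_nonneg (abs_nonneg C) hy0.le)
  have h2 := hC _ (hSE ⟨_, hc, rfl⟩)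
  have h3 : ‖(t + |C| / ‖y‖) • y‖ = t * ‖y‖ + |C| := by
    rw [norm_smul, Real.norm_of_nonneg (by positivity), add_mul, div_mul_cancel₀ _ hy0.ne']
  have h4 : 0 < t * ‖y‖ := by positivity
  have h5 := le_abs_self C
  simp only [h3] at h2
  linarith

end FreeBoundary

end

/-! ### The theorem -/

open FreeBoundary

theorem lemma4p1 (D : Set ℂ) (hD : IsOpen D) (hDb : Bornology.IsBounded D) (h0 : (0 : ℂ) ∈ D)
    (g : ℂ → ℝ) (hg : ContinuousOn g (frontier D)) (hgpos : ∀ x ∈ frontier D, 0 < g x)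
    (f : ℂ → ℝ) (hf : Continuous f) (lam Lam : ℝ) (hlam : 0 < lam)
    (hfb : ∀ x, lam < f x ∧ f x < Lam)
    (M r : ℝ) (hM : 0 < M) (hr : 0 < r) (hDr : D ⊆ Metric.ball 0 r)
    (u : ℂ → ℝ) (hu : FreeBoundary.IsLargestSubsolution D g f lam M r u)
    (x₀ : ℂ) (hx₀ : x₀ ∈ frontier (FreeBoundary.posSet D u))
    (ρ : ℝ) (hρ : 0 < ρ) (hball : Metric.ball x₀ ρ ⊆ Dᶜ) :
    ∀ x ∈ FreeBoundary.zeroInterior (FreeBoundary.normalized u x₀ ρ),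
      ¬ closure (connectedComponentIn
          (FreeBoundary.zeroInterior (FreeBoundary.normalized u x₀ ρ)) x) ⊆
        Metric.ball (0 : ℂ) 1 := by
  intro x hx hcl
  have hfpos : ∀ x, 0 < f x := fun x => hlam.trans (hfb x).1
  have hs := hu.isSubsolution hD hf hfpos
  -- A free boundary point forces u, hence the barrier, to be positive somewhere; this excludes the
  -- degenerate values of R₀.
  obtain ⟨p, hp⟩ : (posSet D u).Nonempty := closure_nonempty_iff.1 ⟨x₀, hx₀.1⟩
  have hR := lt_outerRadius_of_barrier_pos hr (hp.2.trans_le (hu.le_barrier hp.1))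
  have hmax := hu.maximalOn hD h0 hf hfpos hr hR
  set R := outerRadius lam M r
  have hR0 : 0 < R := hr.trans hR
  have hfrE := frontier_rescaling_component hs.nonneg hρ hball hcl
  set Φ := rescaling x₀ hρ.ne' with hΦ
  set E₀ := connectedComponentIn (zeroInterior (normalized u x₀ ρ)) x
  have hE₀o : IsOpen E₀ := isOpen_interior.connectedComponentIn
  have hE₀Z : E₀ ⊆ zeroInterior (normalized u x₀ ρ) := connectedComponentIn_subset _ _
  have hxE₀ : x ∈ E₀ := mem_connectedComponentIn hx
  set E := Φ '' E₀ with hEdef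
  have hE : IsOpen E := Φ.isOpenMap _ hE₀o
  have hEc : IsPreconnected E :=
    isPreconnected_connectedComponentIn.image _ Φ.continuous.continuousOn
  have hclE : closure E ⊆ Metric.ball x₀ ρ := by
    rw [hEdef, ← Φ.image_closure]
    rintro _ ⟨z, hz, rfl⟩
    exact rescaling_mem_ball hρ (hcl hz)
  have hEb : Bornology.IsBounded E := Metric.isBounded_ball.subset (subset_closure.trans hclE)
  have hED : Disjoint (closure E) (closure D) :=
    ((disjoint_compl_left.mono_left hball).closure_right Metric.isOpen_ball).mono_left hclE
  have hEu : ∀ y ∈ E, u y = 0 := by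
    rintro _ ⟨z, hz, rfl⟩
    have h1 : u (x₀ - ρ * z) / ρ = 0 := (interior_subset (hE₀Z hz)).2
    exact (div_eq_zero_iff.1 h1).resolve_right hρ.ne'
  have hpos : posSet D u ⊆ Metric.closedBall 0 R := by
    intro y hy
    by_contra hyR
    rw [mem_closedBall_zero_iff, not_le] at hyR
    have h1 := hu.le_barrier hy.1
    rw [barrier_eq_zero hr hR hyR.le] at h1
    exact h1.not_gt hy.2
  have hEG : E ⊆ Metric.ball 0 R := subset_ball_of_frontier_subset hE hEb hR0
    (hfrE.trans (closure_minimal hpos Metric.isClosed_closedBall))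
  have hxE : Φ x ∈ E := ⟨x, hxE₀, rfl⟩
  -- If ∂E missed the connected ball B_{R₀}, then E would contain it, including the origin, which is
  -- in D.
  have hne : (frontier E ∩ Metric.ball 0 R).Nonempty := by
    by_contra hempty
    rw [Set.not_nonempty_iff_eq_empty] at hempty
    have hsub : Metric.ball 0 R ⊆ E := by
      refine (convex_ball 0 R).isPreconnected.subset_of_closure_inter_subset hE
        ⟨_, hEG hxE, hxE⟩ ?_
      rintro z ⟨hz, hzR⟩
      by_contra hzE
      have : z ∈ frontier E ∩ Metric.ball 0 R := ⟨⟨hz, fun h => hzE (interior_subset h)⟩, hzR⟩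
      rw [hempty] at this
      exact this
    exact hball (hclE (subset_closure (hsub (Metric.mem_ball_self hR0)))) h0
  exact false_of_component hs hmax Metric.isOpen_ball hf hfpos (fun x => (hfb x).2.le) hE hEc hEb
    hED hEG hEu hfrE hne
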